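/- For a finite graph $G$ write $d(G)=2e(G)/v(G)$ for its average degree and $\delta(G)$ for its minimum degree. For $\alpha>0$ let $C_\alpha(G)$ be the minimum number of vertices of a non-empty subgraph $H\subseteq G$ with $d(H)\ge \alpha\, d(G)$. For $X\subseteq V(G)$ let $N_G(X)$ be the set of vertices outside $X$ that have a neighbour in $X$. For $\varepsilon>0$ and an integer $k\ge 1$ put $\rho(y)=0$ if $y<k/5$ and $\rho(y)=\varepsilon/(\log(15y/k))^2$ if $y\ge k/5$. The graph $G$ is an $(\varepsilon,k)$-robust-expander if for every $X\subseteq V(G)$ with $\tfrac k2\le |X|\le \tfrac23|V(G)|$ and every subgraph $F\subseteq G$ with $e(F)\le d(G)\,\rho(|X|)\,|X|$ we have $|N_{G\setminus F}(X)|\ge \rho(|X|)\,|X|$, where $G\setminus F$ is $G$ with the edges of $F$ deleted. Logarithms are natural and $\log^a y=(\log y)^a$. **Lemma.** For all $\beta,\varepsilon\in(0,\tfrac1{150}]$ there are $T_0,c_0>0$ such that for all $T\ge T_0$ and $0<c\le c_0$ there are $n_0,d_0$ for which the following holds. Let $n\ge n_0$ be an integer, let $d\ge d_0$ be real, and let $x,k\ge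 1$ be integers with $x>13$, $k\le n/T$ and $d\ge \log^{25x}n$. Let $G$ be an $n$-vertex $(\varepsilon,k)$-robust-expander with $d(G)\ge d$ and $\delta(G)\ge d/2$, and let $$t=\min\left\{d,\sqrt{\frac{C_\beta(G)}{\log C_\beta(G)}}\right\},\qquad m=\log^4\frac nk .$$ If $k\le t^2m$ and $t^2m^{4x}\le \tfrac13 C_\beta(G)$, then $G$ contains a subdivision of the complete graph $K_{\lceil ct\rceil}$ as a subgraph, that is, a graph obtained from $K_{\lceil ct\rceil}$ by replacing its edges by internally vertex-disjoint paths. -/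

import Mathlib

/-- The average degree `d(G) = 2 e(G) / v(G)` of a finite graph. -/
noncomputable def avgDegree {V : Type*} [Fintype V] (G : SimpleGraph V) : ℝ :=
  2 * (G.edgeSet.ncard : ℝ) / (Fintype.card V : ℝ)

/-- The average degree `d(H) = 2 e(H) / v(H)` of a subgraph `H` of a finite graph; the average is
over the vertices of `H`. -/
noncomputable def subgraphAvgDegree {V : Type*} {G : SimpleGraph V} (H : G.Subgraph) : ℝ :=
  2 * (H.edgeSet.ncard : ℝ) / (H.verts.ncard : ℝ)

/-- An `α`-crux of `G`: a (non-empty) subgraph `H` of `G` with `d(H) ≥ α d(G)`. -/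
def IsCrux {V : Type*} [Fintype V] (α : ℝ) (G : SimpleGraph V) (H : G.Subgraph) : Prop :=
  H.verts.Nonempty ∧ α * avgDegree G ≤ subgraphAvgDegree H

/-- `C_α(G)`: the minimum order of an `α`-crux of `G`. For `α ≤ 1` and `V` non-empty the set is
non-empty, since `G` is an `α`-crux of itself. -/
noncomputable def cruxNumber {V : Type*} [Fintype V] (α : ℝ) (G : SimpleGraph V) : ℕ :=
  sInf {N : ℕ | ∃ H : G.Subgraph, IsCrux α G H ∧ H.verts.ncard = N}

/-- The expansion rate `ρ(x, ε, k)`. -/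
noncomputable def expansionRate (ε : ℝ) (k : ℕ) (x : ℝ) : ℝ :=
  if x < (k : ℝ) / 5 then 0 else ε / (Real.log (15 * x / (k : ℝ))) ^ 2

/-- The external neighbourhood `N_G(X)` of a vertex set `X`. -/
def externalNeighbors {V : Type*} (G : SimpleGraph V) (X : Set V) : Set V :=
  {v : V | v ∉ X ∧ ∃ u ∈ X, G.Adj u v}

/-- `G` is an `(ε, k)`-robust-expander: for every vertex set `X` with `k/2 ≤ |X| ≤ 2|V(G)|/3` and
every subgraph `F` of `G` with `e(F) ≤ d(G) ρ(|X|) |X|`, the set `X` has at least `ρ(|X|) |X|`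
external neighbours after the edges of `F` are deleted from `G`. -/
def IsRobustExpander {V : Type*} [Fintype V] (ε : ℝ) (k : ℕ) (G : SimpleGraph V) : Prop :=
  ∀ X : Finset V,
    (k : ℝ) / 2 ≤ (X.card : ℝ) → (X.card : ℝ) ≤ 2 * (Fintype.card V : ℝ) / 3 →
    ∀ F : SimpleGraph V, F ≤ G →
      (F.edgeSet.ncard : ℝ) ≤
        avgDegree G * expansionRate ε k (X.card : ℝ) * (X.card : ℝ) →
      expansionRate ε k (X.card : ℝ) * (X.card : ℝ) ≤
        ((externalNeighbors (G \ F) (X : Set V)).ncard : ℝ)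

/-- `G` contains a subdivision of `H` as a subgraph: the vertices of `H` are mapped injectively to
branch vertices of `G`, and every edge `ab` of `H` is replaced by a path of `G` between the branch
vertices of `a` and `b`. The path contains no other branch vertex, and the paths of different edges
meet in branch vertices only. The path of `ba` is the path of `ab` reversed, so that there is one
path for each edge. -/
def ContainsSubdivision {W V : Type*} (H : SimpleGraph W) (G : SimpleGraph V) : Prop :=
  ∃ (φ : W ↪ V) (P : ∀ a b : W, H.Adj a b → G.Walk (φ a) (φ b)),
    (∀ (a b : W) (h : H.Adj a b), (P a b h).IsPath) ∧
    (∀ (a b : W) (h : H.Adj a b), P b a h.symm = (P a b h).reverse) ∧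
    (∀ (a b : W) (h : H.Adj a b) (w : W), φ w ∈ (P a b h).support → w = a ∨ w = b) ∧
    (∀ (a b a' b' : W) (h : H.Adj a b) (h' : H.Adj a' b'), s(a, b) ≠ s(a', b') →
      ∀ v : V, v ∈ (P a b h).support → v ∈ (P a' b' h').support → v ∈ Set.range φ)

/-! The proof plays a local expansion against a global one. Write C for `cruxNumber β G`. Locally, a
set with fewer than C vertices spans average degree below β d(G)
(`degSum_lt_of_card_lt_cruxNumber`), so a small set whose vertices have degree at least d(G)/16 into
Y has eight times as many neighbours in Y (`card_nbrs_ge`). Globally, robust expansion joins large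
sets by walks of length polylogarithmic in n/k.

A random vertex set R keeps the two mechanisms disjoint (`exists_splitting_set`). A set S of large
induced minimum degree loses at most a constant factor of its degrees in Γ = S \ R, while through R
any two sets of 2^J vertices are joined by a short walk avoiding any prescribed small set
(`connectsLargeSets_of_expandsAtRate`). There are too many vertex sets for a plain union bound.
However, the regions reached by the walks have the form N[X] with |N[X]| ≥ g|X|, where g = d(G) r
and r is the expansion rate, so they are encoded by the much smaller sets X. The roughly n^|X|
choices are beaten by a failure probability exponentially small in r g |X|, because d(G) exceeds a
large power of log n.

Inside Γ there are q disjoint stars with q leaves each, all of whose leaves expand into the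
remainder Y (`exists_stars_with_expanding_leaves`). For every pair of centres, binary trees of depth
J grow in Y from two reserved leaves, their bottom levels, whose size is of order C, are joined
through R, and only the two used branches are kept. The Friedman–Pippenger method
(`Extendable.exists_child`, `Extendable.link_pair`) allows the rest of the trees to be given back
without damage. Thus all pairs together consume about q² log C vertices of Y, affordable since t²
log C ≤ C, and q² times a power of log(n/k) vertices of R, affordable since t² m^(4x) ≤ C/3. -/

open scoped Classical in
/-- The neighbours of a vertex, as a finite set. -/
noncomputable def nbr {V : Type*} [Fintype V] (G : SimpleGraph V) (v : V) : Finset V :=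
  Finset.univ.filter (G.Adj v)

open scoped Classical in
/-- The vertices with a neighbour in `X`. -/
noncomputable def nbrs {V : Type*} [Fintype V] (G : SimpleGraph V) (X : Finset V) : Finset V :=
  Finset.univ.filter (fun u => ∃ x ∈ X, G.Adj x u)

open scoped Classical in
/-- The closed neighbourhood of a set of vertices. -/
noncomputable def closedNbrs {V : Type*} [Fintype V] (G : SimpleGraph V) (X : Finset V) :
    Finset V :=
  X ∪ nbrs G X

open scoped Classical in
/-- The sum of the degrees of the subgraph induced by `S`. -/
noncomputable def degSum {V : Type*} [Fintype V] (G : SimpleGraph V) (S : Finset V) : ℕ :=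
  ∑ v ∈ S, (nbr G v ∩ S).card

/-! ### Sparsity and expansion of sets smaller than the crux. -/

section LocalStructure
open scoped Classical
variable {V : Type*} [Fintype V] {G : SimpleGraph V}

@[simp] lemma mem_nbr {u v : V} : u ∈ nbr G v ↔ G.Adj v u := by simp [nbr]

@[simp] lemma mem_nbrs {u : V} {X : Finset V} : u ∈ nbrs G X ↔ ∃ x ∈ X, G.Adj x u := by
  simp [nbrs]

@[simp] lemma mem_closedNbrs {u : V} {X : Finset V} :
    u ∈ closedNbrs G X ↔ u ∈ X ∨ ∃ x ∈ X, G.Adj x u := by simp [closedNbrs]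

lemma nbrs_mono {X Y : Finset V} (h : X ⊆ Y) : nbrs G X ⊆ nbrs G Y := by
  intro u hu
  rw [mem_nbrs] at hu ⊢
  obtain ⟨x, hx, hxu⟩ := hu
  exact ⟨x, h hx, hxu⟩

lemma closedNbrs_mono {X Y : Finset V} (h : X ⊆ Y) : closedNbrs G X ⊆ closedNbrs G Y :=
  Finset.union_subset_union h (nbrs_mono h)

lemma nbr_subset_closedNbrs {v : V} {X : Finset V} (hv : v ∈ X) :
    nbr G v ⊆ closedNbrs G X := by
  intro u hu
  rw [mem_closedNbrs]
  exact Or.inr ⟨v, hv, mem_nbr.1 hu⟩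

lemma twice_card_edges_eq_degSum (S : Finset V) (H : SimpleGraph V)
    (hH : ∀ u v, H.Adj u v ↔ G.Adj u v ∧ u ∈ S ∧ v ∈ S) :
    2 * H.edgeSet.ncard = degSum G S := by
  have h1 := H.sum_degrees_eq_twice_card_edges
  have h2 : H.edgeSet.ncard = H.edgeFinset.card := by
    rw [← SimpleGraph.coe_edgeFinset, Set.ncard_coe_finset]
  rw [h2, ← h1, degSum, ← Finset.sum_subset (Finset.subset_univ S)]
  · refine Finset.sum_congr rfl fun v hv => ?_
    rw [← SimpleGraph.card_neighborFinset_eq_degree]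
    congr 1
    ext u
    simp [hH, hv]
  · intro v _ hv
    rw [← SimpleGraph.card_neighborFinset_eq_degree, Finset.card_eq_zero]
    ext u
    simp [hH, hv]

/-- Otherwise the subgraph induced by `S` would be a crux with too few vertices. All local expansion
comes from this bound. -/
lemma degSum_lt_of_card_lt_cruxNumber {β : ℝ} {S : Finset V} (hne : S.Nonempty)
    (hS : S.card < cruxNumber β G) : (degSum G S : ℝ) < β * avgDegree G * S.card := by
  by_contra hcon
  push Not at hcon
  have hpos : (0 : ℝ) < S.card := by exact_mod_cast hne.card_pos
  let K : SimpleGraph V :=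
    { Adj := fun u v => G.Adj u v ∧ u ∈ S ∧ v ∈ S
      symm := ⟨fun u v h => ⟨h.1.symm, h.2.2, h.2.1⟩⟩
      loopless := ⟨fun u h => G.loopless.irrefl u h.1⟩ }
  let H : G.Subgraph :=
    { verts := S
      Adj := fun u v => G.Adj u v ∧ u ∈ S ∧ v ∈ S
      adj_sub := fun h => h.1
      edge_vert := fun h => h.2.1
      symm := ⟨fun u v h => ⟨h.1.symm, h.2.2, h.2.1⟩⟩ }
  have hE : H.edgeSet = K.edgeSet := by
    ext e
    induction e with
    | _ u v => exact Iff.rfl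
  have hcard : H.verts.ncard = S.card := Set.ncard_coe_finset S
  have h2 : 2 * K.edgeSet.ncard = degSum G S :=
    twice_card_edges_eq_degSum S K fun u v => Iff.rfl
  have hc : IsCrux β G H := by
    refine ⟨hne, ?_⟩
    rw [subgraphAvgDegree, hcard, hE, le_div_iff₀ hpos]
    rw [← h2] at hcon
    push_cast at hcon
    exact hcon
  have := Nat.sInf_le (s := {N : ℕ | ∃ H : G.Subgraph, IsCrux β G H ∧ H.verts.ncard = N})
    ⟨H, hc, hcard⟩
  exact absurd this (not_le.2 hS)

lemma degSum_univ [Nonempty V] : (degSum G Finset.univ : ℝ) = avgDegree G * Fintype.card V := by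
  have h := twice_card_edges_eq_degSum (G := G) Finset.univ G (by simp)
  have hpos : (Fintype.card V : ℝ) ≠ 0 := by exact_mod_cast Fintype.card_ne_zero
  rw [avgDegree, div_mul_cancel₀ _ hpos, ← h]
  push_cast
  ring

lemma degSum_insert {S : Finset V} {v : V} (hv : v ∉ S) :
    degSum G (insert v S) = degSum G S + 2 * (nbr G v ∩ S).card := by
  have h1 : nbr G v ∩ insert v S = nbr G v ∩ S := by
    ext u
    simp only [Finset.mem_inter, mem_nbr, Finset.mem_insert]
    refine ⟨fun ⟨h, h'⟩ => ⟨h, h'.resolve_left ?_⟩, fun ⟨h, h'⟩ => ⟨h, Or.inr h'⟩⟩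
    rintro rfl
    exact G.loopless.irrefl _ h
  have h2 : ∀ u ∈ S, (nbr G u ∩ insert v S).card
      = (nbr G u ∩ S).card + if G.Adj v u then 1 else 0 := by
    intro u _
    by_cases huv : G.Adj v u
    · rw [if_pos huv, Finset.inter_insert_of_mem (mem_nbr.2 huv.symm),
        Finset.card_insert_of_notMem (by simp [hv])]
    · rw [if_neg huv, Finset.inter_insert_of_notMem (fun h => huv (mem_nbr.1 h).symm), add_zero]
  rw [degSum, Finset.sum_insert hv, h1, Finset.sum_congr rfl h2, Finset.sum_add_distrib,
    Finset.sum_ite, Finset.sum_const_zero, add_zero, Finset.sum_const, smul_eq_mul, mul_one]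
  have h3 : S.filter (G.Adj v) = nbr G v ∩ S := by
    ext u
    simp [and_comm]
  rw [h3, degSum]
  ring

/-- A minimal set whose induced average degree is at least d(G) works: deleting a vertex of degree
below d(G)/2 would not lower the average. The bound is relative to d(G), which may be much larger
than `d`. -/
lemma exists_minDegree_subset [Nonempty V] (hD : 0 < avgDegree G) :
    ∃ S : Finset V, S.Nonempty ∧ ∀ v ∈ S, avgDegree G / 2 ≤ ((nbr G v ∩ S).card : ℝ) := by
  let P : Finset V → Prop := fun S => S.Nonempty ∧ avgDegree G * S.card ≤ degSum G S
  have hP : ∃ S, P S := ⟨Finset.univ, Finset.univ_nonempty, by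
    rw [degSum_univ, Finset.card_univ]⟩
  obtain ⟨S, hS⟩ := hP
  obtain ⟨S, -, hmin⟩ := (Set.toFinite {S | P S}).exists_le_minimal hS
  refine ⟨S, hmin.1.1, fun v hv => ?_⟩
  by_contra hlt
  push Not at hlt
  have h1 := degSum_insert (G := G) (Finset.notMem_erase v S)
  rw [Finset.insert_erase hv] at h1
  have h4 : (nbr G v ∩ S.erase v).card ≤ (nbr G v ∩ S).card :=
    Finset.card_le_card (Finset.inter_subset_inter_left (Finset.erase_subset _ _))
  have h5 : ((nbr G v ∩ S.erase v).card : ℝ) ≤ (nbr G v ∩ S).card := by exact_mod_cast h4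
  have h2 := hmin.1.2
  have h3 := Finset.card_erase_add_one hv
  have h6 : ((S.erase v).card : ℝ) + 1 = S.card := by exact_mod_cast h3
  rw [h1, ← h6] at h2
  push_cast at h2
  have hle : avgDegree G * (S.erase v).card ≤ degSum G (S.erase v) := by nlinarith
  rcases (S.erase v).eq_empty_or_nonempty with he | he
  · rw [he] at h2 h5
    simp [degSum] at h2
    linarith
  · have := hmin.2 (y := S.erase v) ⟨he, hle⟩ (Finset.erase_subset _ _)
    exact Finset.notMem_erase v S (this hv)

lemma cruxNumber_le_of_minDegree {β : ℝ} {S : Finset V} (hne : S.Nonempty)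
    (hdeg : ∀ v ∈ S, β * avgDegree G ≤ ((nbr G v ∩ S).card : ℝ)) : cruxNumber β G ≤ S.card := by
  by_contra h
  push Not at h
  have h1 := degSum_lt_of_card_lt_cruxNumber hne h
  have h2 : (S.card : ℝ) * (β * avgDegree G) ≤ degSum G S := by
    rw [degSum, Nat.cast_sum, ← nsmul_eq_mul]
    exact Finset.card_nsmul_le_sum _ _ _ hdeg
  linarith

/-- Starting from `U`, keep adding vertices of Γ with at least d(G)/16 neighbours in the current
set; each adds d(G)/8 to the degree sum. On reaching 2|U| vertices the set would have average degree
at least d(G)/16 > β d(G) while being smaller than the crux. So the process stops earlier, and then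
every vertex left outside keeps half of its degree d(G)/8. -/
lemma exists_closure {β : ℝ} (hβ : β < 1 / 16) (hD : 0 < avgDegree G) {Γ U : Finset V}
    (hΓ : ∀ v ∈ Γ, avgDegree G / 8 ≤ ((nbr G v ∩ Γ).card : ℝ)) (hU : U ⊆ Γ)
    (hcard : 2 * U.card < cruxNumber β G) :
    ∃ B : Finset V, U ⊆ B ∧ B ⊆ Γ ∧ B.card ≤ 2 * U.card ∧
      ∀ v ∈ Γ \ B, avgDegree G / 16 ≤ ((nbr G v ∩ (Γ \ B)).card : ℝ) := by
  let P : Finset V → Prop := fun B => U ⊆ B ∧ B ⊆ Γ ∧ B.card ≤ 2 * U.card ∧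
    avgDegree G / 8 * ((B.card : ℝ) - U.card) ≤ degSum G B
  have h0 : P U := ⟨subset_rfl, hU, by omega, by simp⟩
  obtain ⟨B, -, hmax⟩ := (Set.toFinite {B | P B}).exists_le_maximal h0
  obtain ⟨hUB, hBΓ, hBc, hBd⟩ := hmax.1
  refine ⟨B, hUB, hBΓ, hBc, fun v hv => ?_⟩
  by_contra hlt
  push Not at hlt
  obtain ⟨hvΓ, hvB⟩ := Finset.mem_sdiff.1 hv
  have h1 : (nbr G v ∩ Γ).card ≤ (nbr G v ∩ (Γ \ B)).card + (nbr G v ∩ B).card := by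
    refine (Finset.card_le_card ?_).trans (Finset.card_union_le _ _)
    intro u hu
    by_cases huB : u ∈ B <;> simp_all
  have h1' : ((nbr G v ∩ Γ).card : ℝ) ≤ (nbr G v ∩ (Γ \ B)).card + (nbr G v ∩ B).card := by
    exact_mod_cast h1
  have h2 := hΓ v hvΓ
  have h3 : avgDegree G / 16 ≤ ((nbr G v ∩ B).card : ℝ) := by linarith
  rcases hBc.lt_or_eq with hBlt | hBeq
  · have hP : P (insert v B) := by
      refine ⟨hUB.trans (Finset.subset_insert _ _), Finset.insert_subset hvΓ hBΓ, ?_, ?_⟩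
      · rw [Finset.card_insert_of_notMem hvB]; omega
      · rw [degSum_insert hvB, Finset.card_insert_of_notMem hvB]
        push_cast
        linarith
    exact hvB (hmax.2 hP (Finset.subset_insert _ _) (Finset.mem_insert_self _ _))
  · have hBne : B.Nonempty := by
      by_contra hB
      rw [Finset.not_nonempty_iff_eq_empty] at hB
      rw [hB] at h3
      simp at h3
      linarith
    have h4 := degSum_lt_of_card_lt_cruxNumber (G := G) (β := β) hBne (by omega)
    have h5 : (B.card : ℝ) = 2 * U.card := by exact_mod_cast hBeq
    have h6 : (0 : ℝ) < B.card := by exact_mod_cast hBne.card_pos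
    have h7 : (U.card : ℝ) = B.card / 2 := by linarith
    rw [h7] at hBd
    have h8 : β * (avgDegree G * B.card) < 1 / 16 * (avgDegree G * B.card) :=
      mul_lt_mul_of_pos_right hβ (mul_pos hD h6)
    linarith

lemma degSum_le_of_subset {X Y B : Finset V} (hX : X ⊆ B) (hY : Y ⊆ B) :
    ∑ v ∈ X, (nbr G v ∩ Y).card ≤ degSum G B :=
  (Finset.sum_le_sum fun _ _ => Finset.card_le_card (Finset.inter_subset_inter_left hY)).trans
    (Finset.sum_le_sum_of_subset hX)

/-- All edges counted by `hX` lie inside Z = X ∪ (N(X) ∩ Y). If Z is smaller than the crux, then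
|X|/16 < |Z|/150, and hence |Z| ≥ 9|X|; otherwise this holds by `hcard`. -/
lemma card_nbrs_ge {β : ℝ} (hβ : β ≤ 1 / 150) (hD : 0 < avgDegree G) {X Y : Finset V}
    (hX : ∀ v ∈ X, avgDegree G / 16 ≤ ((nbr G v ∩ Y).card : ℝ))
    (hcard : 9 * X.card ≤ cruxNumber β G) :
    8 * X.card ≤ (nbrs G X ∩ Y).card := by
  rcases X.eq_empty_or_nonempty with rfl | hne
  · simp
  set Z := X ∪ (nbrs G X ∩ Y) with hZ
  have hZc : Z.card ≤ X.card + (nbrs G X ∩ Y).card := Finset.card_union_le _ _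
  by_cases hlt : Z.card < cruxNumber β G
  · have h1 := degSum_lt_of_card_lt_cruxNumber (G := G) (β := β)
      (hne.mono (Finset.subset_union_left : X ⊆ Z)) hlt
    have h2 : ∑ v ∈ X, (nbr G v ∩ (nbrs G X ∩ Y)).card ≤ degSum G Z :=
      degSum_le_of_subset Finset.subset_union_left Finset.subset_union_right
    have h3 : (X.card : ℝ) * (avgDegree G / 16) ≤
        ((∑ v ∈ X, (nbr G v ∩ (nbrs G X ∩ Y)).card : ℕ) : ℝ) := by
      rw [Nat.cast_sum, ← nsmul_eq_mul]
      refine Finset.card_nsmul_le_sum _ _ _ fun v hv => (hX v hv).trans ?_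
      norm_cast
      refine Finset.card_le_card fun u hu => ?_
      simp only [Finset.mem_inter, mem_nbr, mem_nbrs] at hu ⊢
      exact ⟨hu.1, ⟨v, hv, hu.1⟩, hu.2⟩
    have h4 : ((∑ v ∈ X, (nbr G v ∩ (nbrs G X ∩ Y)).card : ℕ) : ℝ) ≤ degSum G Z := by
      exact_mod_cast h2
    have h5 : (0 : ℝ) < X.card := by exact_mod_cast hne.card_pos
    have h6 : β * (avgDegree G * Z.card) ≤ 1 / 150 * (avgDegree G * Z.card) :=
      mul_le_mul_of_nonneg_right hβ (by positivity)
    have h7 : avgDegree G * (X.card / 16) < avgDegree G * (Z.card / 150) := by linarith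
    have h8 := lt_of_mul_lt_mul_left h7 hD.le
    have h9 : (9 * X.card : ℝ) ≤ Z.card := by linarith
    have h10 : 9 * X.card ≤ Z.card := by exact_mod_cast h9
    omega
  · omega

end LocalStructure

/-! ### Random splitting of the vertex set. -/

section RandomSplit
open scoped Classical

/-- The factor contributed by one vertex to the Chernoff bound below. The two sides are about 0.684
and 0.687, which is why explicit decimals are needed. -/
lemma half_one_add_exp_neg_one_le : (1 + Real.exp (-1)) / 2 ≤ Real.exp (-(3 / 8)) := by
  have h1 : Real.exp (-1) < 0.367879442 := by
    have := Real.exp_neg_one_lt_d9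
    norm_num at this ⊢
    linarith
  have h2 : Real.exp (3 / 8) ≤ 1.462 := by
    have h3 : Real.exp (3 / 8) ^ 8 = Real.exp 1 ^ 3 := by
      rw [← Real.exp_nat_mul, ← Real.exp_nat_mul]
      norm_num
    have h4 : Real.exp 1 ^ 3 ≤ 2.7182818286 ^ 3 :=
      pow_le_pow_left₀ (Real.exp_pos _).le Real.exp_one_lt_d9.le 3
    by_contra h5
    push Not at h5
    have h6 : (1.462 : ℝ) ^ 8 < Real.exp (3 / 8) ^ 8 :=
      pow_lt_pow_left₀ h5 (by norm_num) (by norm_num)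
    rw [h3] at h6
    norm_num at h4 h6
    linarith
  rw [Real.exp_neg (3 / 8)]
  have h7 : (1.462 : ℝ)⁻¹ ≤ (Real.exp (3 / 8))⁻¹ := inv_anti₀ (Real.exp_pos _) h2
  norm_num at h1 h7
  linarith

/-- Exponential Markov inequality for a uniformly random `R`, in counting form: the sum of exp(-|Y ∩
R|) over all `R` factorises over the vertices. The rate is 3/8 - 1/4 = 1/8. -/
lemma card_filter_inter_lt_le {V : Type*} [Fintype V] (Y : Finset V) :
    (((Finset.univ : Finset (Finset V)).filter
      (fun R => ((Y ∩ R).card : ℝ) < (Y.card : ℝ) / 4)).card : ℝ) ≤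
      2 ^ Fintype.card V * Real.exp (-(Y.card : ℝ) / 8) := by
  set 𝓑 := (Finset.univ : Finset (Finset V)).filter
      (fun R => ((Y ∩ R).card : ℝ) < (Y.card : ℝ) / 4) with h𝓑
  have h1 : ∑ R : Finset V, Real.exp (-((Y ∩ R).card : ℝ)) =
      ∏ v : V, (1 + if v ∈ Y then Real.exp (-1) else 1) := by
    rw [Finset.prod_one_add, Finset.powerset_univ]
    refine Finset.sum_congr rfl fun R _ => ?_
    rw [Finset.prod_ite, Finset.prod_const, Finset.prod_const_one, mul_one, ← Real.exp_nat_mul]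
    congr 1
    rw [Finset.filter_mem_eq_inter, Finset.inter_comm]
    ring
  have h2 : ∏ v : V, (1 + if v ∈ Y then Real.exp (-1) else 1) =
      2 ^ Fintype.card V * ((1 + Real.exp (-1)) / 2) ^ Y.card := by
    have h3 : ∀ v : V, (1 + if v ∈ Y then Real.exp (-1) else 1) =
        2 * (if v ∈ Y then (1 + Real.exp (-1)) / 2 else 1) := by
      intro v
      split_ifs <;> ring
    simp_rw [h3]
    rw [Finset.prod_mul_distrib, Finset.prod_const, Finset.card_univ, Finset.prod_ite,
      Finset.prod_const, Finset.prod_const_one, mul_one]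
    simp
  have h4 : ((1 + Real.exp (-1)) / 2) ^ Y.card ≤ Real.exp (-(3 / 8) * Y.card) := by
    rw [mul_comm, Real.exp_nat_mul]
    exact pow_le_pow_left₀ (by positivity) half_one_add_exp_neg_one_le _
  have h5 : (𝓑.card : ℝ) * Real.exp (-(Y.card : ℝ) / 4) ≤
      ∑ R : Finset V, Real.exp (-((Y ∩ R).card : ℝ)) := by
    calc (𝓑.card : ℝ) * Real.exp (-(Y.card : ℝ) / 4)
        = ∑ R ∈ 𝓑, Real.exp (-(Y.card : ℝ) / 4) := by rw [Finset.sum_const, nsmul_eq_mul]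
      _ ≤ ∑ R ∈ 𝓑, Real.exp (-((Y ∩ R).card : ℝ)) := by
          refine Finset.sum_le_sum fun R hR => Real.exp_le_exp.2 ?_
          have := (Finset.mem_filter.1 hR).2
          linarith
      _ ≤ _ := Finset.sum_le_sum_of_subset_of_nonneg (Finset.subset_univ _)
          fun _ _ _ => (Real.exp_pos _).le
  rw [h1, h2] at h5
  have h6 : (𝓑.card : ℝ) * Real.exp (-(Y.card : ℝ) / 4) ≤
      2 ^ Fintype.card V * Real.exp (-(3 / 8) * Y.card) :=
    h5.trans (mul_le_mul_of_nonneg_left h4 (by positivity))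
  have h7 : Real.exp (-(3 / 8) * (Y.card : ℝ)) =
      Real.exp (-(Y.card : ℝ) / 8) * Real.exp (-(Y.card : ℝ) / 4) := by
    rw [← Real.exp_add]
    congr 1
    ring
  rw [h7, ← mul_assoc] at h6
  exact le_of_mul_le_mul_right h6 (Real.exp_pos _)

/-- Union bound. Complementing `R` exchanges the two kinds of failure, so they are equally frequent;
this costs the factor 2 behind the bound 1/2. -/
lemma exists_split {V ι : Type*} [Fintype V] (s : Finset ι) (Y : ι → Finset V)
    (h : ∑ i ∈ s, Real.exp (-((Y i).card : ℝ) / 8) < 1 / 2) :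
    ∃ R : Finset V, ∀ i ∈ s, ((Y i).card : ℝ) / 4 ≤ ((Y i ∩ R).card : ℝ) ∧
      ((Y i).card : ℝ) / 4 ≤ ((Y i \ R).card : ℝ) := by
  by_contra hcon
  push Not at hcon
  let 𝓑 : ι → Finset (Finset V) := fun i => Finset.univ.filter
    (fun R => ((Y i ∩ R).card : ℝ) < ((Y i).card : ℝ) / 4)
  let 𝓒 : ι → Finset (Finset V) := fun i => Finset.univ.filter
    (fun R => ((Y i \ R).card : ℝ) < ((Y i).card : ℝ) / 4)
  have hC : ∀ i, (𝓒 i).card ≤ (𝓑 i).card := by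
    intro i
    refine Finset.card_le_card_of_injOn (fun R => Rᶜ) ?_ (compl_injective.injOn)
    intro R hR
    simp only [𝓑, 𝓒, Finset.coe_filter, Finset.mem_univ, true_and, Set.mem_ofPred_eq] at hR ⊢
    rwa [← Finset.sdiff_eq_inter_compl]
  have hcover : (Finset.univ : Finset (Finset V)) ⊆ s.biUnion (fun i => 𝓑 i ∪ 𝓒 i) := by
    intro R _
    obtain ⟨i, hi, hR⟩ := hcon R
    rw [Finset.mem_biUnion]
    refine ⟨i, hi, ?_⟩
    by_cases h1 : ((Y i).card : ℝ) / 4 ≤ ((Y i ∩ R).card : ℝ)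
    · exact Finset.mem_union_right _ (Finset.mem_filter.2 ⟨Finset.mem_univ _, hR h1⟩)
    · exact Finset.mem_union_left _ (Finset.mem_filter.2 ⟨Finset.mem_univ _, not_le.1 h1⟩)
  have h1 : Fintype.card (Finset V) ≤ ∑ i ∈ s, 2 * (𝓑 i).card := by
    refine (Finset.card_le_card hcover).trans (Finset.card_biUnion_le.trans ?_)
    refine Finset.sum_le_sum fun i _ => (Finset.card_union_le _ _).trans ?_
    have := hC i
    omega
  have h2 : ((2 : ℝ) ^ Fintype.card V) ≤ ∑ i ∈ s, 2 * ((𝓑 i).card : ℝ) := by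
    rw [Fintype.card_finset] at h1
    exact_mod_cast h1
  have h3 : ∑ i ∈ s, 2 * ((𝓑 i).card : ℝ) ≤
      ∑ i ∈ s, 2 * (2 ^ Fintype.card V * Real.exp (-((Y i).card : ℝ) / 8)) :=
    Finset.sum_le_sum fun i _ =>
      mul_le_mul_of_nonneg_left (card_filter_inter_lt_le (Y i)) (by norm_num)
  rw [← Finset.mul_sum, ← Finset.mul_sum, ← Finset.mul_sum] at h3
  rw [← Finset.mul_sum] at h2
  have h4 : (0 : ℝ) < 2 ^ Fintype.card V := by positivity
  nlinarith

/-- The sum is (1 + 1/n)^n. Weights n^(-|X|) thus make a union bound over all vertex sets converge.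
-/
lemma sum_inv_card_pow_le (V : Type*) [Fintype V] [Nonempty V] :
    ∑ X : Finset V, ((Fintype.card V : ℝ)⁻¹) ^ X.card ≤ Real.exp 1 := by
  have h1 : ∑ X : Finset V, ((Fintype.card V : ℝ)⁻¹) ^ X.card =
      ∏ v : V, (1 + (Fintype.card V : ℝ)⁻¹) := by
    rw [Finset.prod_one_add, Finset.powerset_univ]
    exact Finset.sum_congr rfl fun X _ => by rw [Finset.prod_const]
  rw [h1, Finset.prod_const, Finset.card_univ]
  have h2 : (Fintype.card V : ℝ) ≠ 0 := by exact_mod_cast Fintype.card_ne_zero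
  calc (1 + (Fintype.card V : ℝ)⁻¹) ^ Fintype.card V
      ≤ Real.exp ((Fintype.card V : ℝ)⁻¹) ^ Fintype.card V := by
        refine pow_le_pow_left₀ (by positivity) ?_ _
        linarith [Real.add_one_le_exp ((Fintype.card V : ℝ)⁻¹)]
    _ = Real.exp 1 := by rw [← Real.exp_nat_mul, mul_inv_cancel₀ h2]

/-- For two set-valued functions on pairs of vertex sets, a random set meets every value that is
large compared with its arguments, and splits the members of a family of at most `|V|` large
sets. -/
lemma exists_splitting_set {V : Type*} [Fintype V] [Nonempty V] {κ a : ℝ}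
    (hlog : 1 ≤ Real.log (Fintype.card V)) (hκ : κ = 40 * Real.log (Fintype.card V))
    (ha : 8 * Real.log (Fintype.card V) + 40 ≤ a)
    (Y₁ Y₂ : Finset V → Finset V → Finset V) (S : Finset V) (N : V → Finset V)
    (hN : ∀ v ∈ S, a ≤ ((N v).card : ℝ)) :
    ∃ R : Finset V, (∀ v ∈ S, ((N v).card : ℝ) / 4 ≤ ((N v \ R).card : ℝ)) ∧
      (∀ X X' : Finset V, κ * (X.card + X'.card + 1) ≤ ((Y₁ X X').card : ℝ) →
        ((Y₁ X X').card : ℝ) / 4 ≤ ((Y₁ X X' ∩ R).card : ℝ)) ∧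
      (∀ X X' : Finset V, κ * (X.card + X'.card + 1) ≤ ((Y₂ X X').card : ℝ) →
        ((Y₂ X X').card : ℝ) / 4 ≤ ((Y₂ X X' ∩ R).card : ℝ)) := by
  set n : ℝ := (Fintype.card V : ℝ) with hn
  have hn0 : 0 < n := by rw [hn]; exact_mod_cast Fintype.card_pos
  let good : (Finset V → Finset V → Finset V) → Finset (Finset V × Finset V) := fun Y =>
    Finset.univ.filter (fun p => κ * (p.1.card + p.2.card + 1) ≤ ((Y p.1 p.2).card : ℝ))
  have hpair : ∀ Y : Finset V → Finset V → Finset V,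
      ∑ p ∈ good Y, Real.exp (-((Y p.1 p.2).card : ℝ) / 8) ≤ Real.exp (-3) := by
    intro Y
    -- With κ = 40 log n, one eighth of |Y| is at least 5 log n (|X| + |X'| + 1). This pays for the
    -- weights n^(-|X|) and n^(-|X'|) and leaves a factor e^(-5), since log n ≥ 1.
    have h1 : ∀ p ∈ good Y, Real.exp (-((Y p.1 p.2).card : ℝ) / 8) ≤
        Real.exp (-5) * (n⁻¹ ^ p.1.card * n⁻¹ ^ p.2.card) := by
      intro p hp
      have hp := (Finset.mem_filter.1 hp).2
      have h2 : n⁻¹ ^ p.1.card * n⁻¹ ^ p.2.card =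
          Real.exp (-(Real.log n * (p.1.card + p.2.card))) := by
        rw [← pow_add, inv_pow, Real.exp_neg, ← Nat.cast_add, mul_comm (Real.log n),
          Real.exp_nat_mul, Real.exp_log hn0]
      rw [h2, ← Real.exp_add]
      refine Real.exp_le_exp.2 ?_
      rw [hκ] at hp
      have h3 : (0 : ℝ) ≤ (p.1.card : ℝ) + p.2.card := by positivity
      nlinarith
    refine (Finset.sum_le_sum h1).trans ?_
    rw [← Finset.mul_sum]
    have h4 : ∑ p ∈ good Y, n⁻¹ ^ p.1.card * n⁻¹ ^ p.2.card ≤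
        ∑ p : Finset V × Finset V, n⁻¹ ^ p.1.card * n⁻¹ ^ p.2.card :=
      Finset.sum_le_sum_of_subset_of_nonneg (Finset.subset_univ _) fun _ _ _ => by positivity
    have h5 : ∑ p : Finset V × Finset V, n⁻¹ ^ p.1.card * n⁻¹ ^ p.2.card =
        (∑ X : Finset V, n⁻¹ ^ X.card) * (∑ X : Finset V, n⁻¹ ^ X.card) := by
      rw [Fintype.sum_prod_type, Finset.sum_mul_sum]
    have h6 := sum_inv_card_pow_le V
    have h7 : (∑ X : Finset V, n⁻¹ ^ X.card) * (∑ X : Finset V, n⁻¹ ^ X.card) ≤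
        Real.exp 1 * Real.exp 1 :=
      mul_le_mul h6 h6 (Finset.sum_nonneg fun _ _ => by positivity) (Real.exp_pos _).le
    calc _ ≤ Real.exp (-5) * (Real.exp 1 * Real.exp 1) :=
          mul_le_mul_of_nonneg_left (h4.trans (h5.le.trans h7)) (Real.exp_pos _).le
      _ = Real.exp (-3) := by
          rw [← Real.exp_add, ← Real.exp_add]
          norm_num
  have hvert : ∑ v ∈ S, Real.exp (-((N v).card : ℝ) / 8) ≤ Real.exp (-3) := by
    have h1 : ∀ v ∈ S, Real.exp (-((N v).card : ℝ) / 8) ≤ Real.exp (-3) * n⁻¹ := by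
      intro v hv
      have h2 : n⁻¹ = Real.exp (-Real.log n) := by rw [Real.exp_neg, Real.exp_log hn0]
      rw [h2, ← Real.exp_add]
      refine Real.exp_le_exp.2 ?_
      have := hN v hv
      linarith
    refine (Finset.sum_le_sum h1).trans ?_
    rw [Finset.sum_const, nsmul_eq_mul]
    have h3 : (S.card : ℝ) ≤ n := by rw [hn]; exact_mod_cast Finset.card_le_univ S
    have h4 : (S.card : ℝ) * n⁻¹ ≤ 1 := by rw [← div_eq_mul_inv, div_le_one hn0]; exact h3
    nlinarith [Real.exp_pos (-3)]
  -- There are three families, each of total failure weight at most e^(-3), and `exists_split` needs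
  -- a sum below 1/2.
  have hexp : Real.exp (-3) < 1 / 6 := by
    have h1 : Real.exp (-3) = Real.exp (-1) ^ 3 := by
      rw [← Real.exp_nat_mul]
      norm_num
    have h2 := Real.exp_neg_one_lt_d9
    rw [h1]
    calc Real.exp (-1) ^ 3 ≤ (1 / 2) ^ 3 := by
          refine pow_le_pow_left₀ (Real.exp_pos _).le ?_ 3
          norm_num at h2 ⊢
          linarith
      _ < 1 / 6 := by norm_num
  let Z : V ⊕ ((Finset V × Finset V) ⊕ (Finset V × Finset V)) → Finset V :=
    Sum.elim N (Sum.elim (fun p => Y₁ p.1 p.2) (fun p => Y₂ p.1 p.2))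
  obtain ⟨R, hR⟩ := exists_split (S.disjSum ((good Y₁).disjSum (good Y₂))) Z (by
    rw [Finset.sum_disjSum, Finset.sum_disjSum]
    have h1 := hpair Y₁
    have h2 := hpair Y₂
    simp only [Z, Sum.elim_inl, Sum.elim_inr]
    linarith)
  refine ⟨R, fun v hv => ?_, fun X X' h => ?_, fun X X' h => ?_⟩
  · exact (hR (Sum.inl v) (by simpa using hv)).2
  · exact (hR (Sum.inr (Sum.inl (X, X'))) (by simpa [good] using h)).1
  · exact (hR (Sum.inr (Sum.inr (X, X'))) (by simpa [good] using h)).1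

end RandomSplit

/-! ### Connecting large sets through the random set. -/

/-- A walk of length at most `i` from `A` to `z` all of whose vertices but the first are
in `Q`. -/
def ReachableThrough {V : Type*} (G : SimpleGraph V) (A Q : Finset V) (i : ℕ) (z : V) : Prop :=
  ∃ a ∈ A, ∃ p : G.Walk a z, p.length ≤ i ∧ ∀ u ∈ p.support, u = a ∨ u ∈ Q

lemma ReachableThrough.mono {V : Type*} {G : SimpleGraph V} {A Q : Finset V} {i j : ℕ} {z : V} (hij : i ≤ j)
    (h : ReachableThrough G A Q i z) : ReachableThrough G A Q j z := by
  obtain ⟨a, ha, p, hp, hs⟩ := h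
  exact ⟨a, ha, p, hp.trans hij, hs⟩

section Connecting
open scoped Classical
variable {V : Type*} [Fintype V] {G : SimpleGraph V}

/-- The vertices in the closed neighbourhood of `X` with at least `g` neighbours outside the closed
neighbourhood of `X'`. -/
noncomputable def expandingPart (G : SimpleGraph V) (g : ℝ) (X X' : Finset V) : Finset V :=
  (closedNbrs G X).filter (fun z => g ≤ ((nbr G z \ closedNbrs G X').card : ℝ))

/-- Robust expansion at a constant rate. -/
def ExpandsAtRate (G : SimpleGraph V) (k r : ℝ) : Prop :=
  ∀ X : Finset V, k / 2 ≤ (X.card : ℝ) → (X.card : ℝ) ≤ 2 * (Fintype.card V : ℝ) / 3 →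
    ∀ F : SimpleGraph V, F ≤ G → (F.edgeSet.ncard : ℝ) ≤ avgDegree G * r * (X.card : ℝ) →
      r * (X.card : ℝ) ≤ ((externalNeighbors (G \ F) (X : Set V)).ncard : ℝ)

/-- If few vertices of Z had `g` neighbours outside Z', then removing these few vertices from Z, and
all edges from the remaining set X to the outside of Z', would be a deletion permitted by
robustness. It confines the neighbourhood of X to (Z' \ Z) ∪ K, with fewer than r|Z|/2 ≤ r|X| +
r|Z|/2 - r|Z|/2 vertices, against expansion of X. -/
lemma card_expanding_ge {k r g : ℝ} (hexp : ExpandsAtRate G k r) (hk : 0 < k) (hr : 0 < r)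
    (hr' : r ≤ 1) (hg : g ≤ avgDegree G * r) {Z Z' : Finset V}
    (hkZ : k ≤ (Z.card : ℝ)) (hZn : (Z.card : ℝ) ≤ 2 * (Fintype.card V : ℝ) / 3)
    (hsmall : ((Z' \ Z).card : ℝ) < r * Z.card / 4) :
    r * Z.card / 4 ≤ ((Z.filter (fun z => g ≤ ((nbr G z \ Z').card : ℝ))).card : ℝ) := by
  by_contra hcon
  push Not at hcon
  set K := Z.filter (fun z => g ≤ ((nbr G z \ Z').card : ℝ)) with hK
  set X := Z \ K with hX
  have hKZ : K ⊆ Z := Finset.filter_subset _ _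
  have hXc : (X.card : ℝ) + K.card = Z.card := by
    exact_mod_cast Finset.card_sdiff_add_card_eq_card hKZ
  have hXle : (X.card : ℝ) ≤ Z.card := by linarith [(Nat.cast_nonneg K.card : (0 : ℝ) ≤ K.card)]
  have hrZ : r * Z.card ≤ 1 * Z.card := mul_le_mul_of_nonneg_right hr' (Nat.cast_nonneg _)
  have hXge : (Z.card : ℝ) / 2 ≤ X.card := by linarith
  let F : SimpleGraph V :=
    { Adj := fun u v => G.Adj u v ∧ ((u ∈ X ∧ v ∉ Z') ∨ (v ∈ X ∧ u ∉ Z'))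
      symm := ⟨fun u v h => ⟨h.1.symm, h.2.symm⟩⟩
      loopless := ⟨fun u h => G.loopless.irrefl u h.1⟩ }
  have hF : F ≤ G := fun u v h => h.1
  have hsub : F.edgeSet ⊆
      ((X.sigma (fun x => nbr G x \ Z')).image (fun p => s(p.1, p.2)) : Finset (Sym2 V)) := by
    intro e
    induction e with
    | _ u v =>
      intro h
      have h : G.Adj u v ∧ ((u ∈ X ∧ v ∉ Z') ∨ (v ∈ X ∧ u ∉ Z')) := h
      simp only [Finset.coe_image, Set.mem_image, Finset.mem_coe, Finset.mem_sigma,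
        Finset.mem_sdiff, mem_nbr]
      rcases h.2 with h' | h'
      · exact ⟨⟨u, v⟩, ⟨h'.1, h.1, h'.2⟩, rfl⟩
      · exact ⟨⟨v, u⟩, ⟨h'.1, h.1.symm, h'.2⟩, Sym2.eq_swap⟩
  have hFc : (F.edgeSet.ncard : ℝ) ≤ avgDegree G * r * X.card := by
    have h1 : F.edgeSet.ncard ≤ ∑ x ∈ X, (nbr G x \ Z').card := by
      refine (Set.ncard_le_ncard hsub (Finset.finite_toSet _)).trans ?_
      rw [Set.ncard_coe_finset]
      exact Finset.card_image_le.trans (Finset.card_sigma _ _).le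
    have h2 : ((∑ x ∈ X, (nbr G x \ Z').card : ℕ) : ℝ) ≤ X.card * g := by
      rw [Nat.cast_sum, ← nsmul_eq_mul]
      refine Finset.sum_le_card_nsmul _ _ _ fun x hx => ?_
      obtain ⟨hxZ, hxK⟩ := Finset.mem_sdiff.1 hx
      by_contra hlt
      exact hxK (Finset.mem_filter.2 ⟨hxZ, (not_le.1 hlt).le⟩)
    have h3 : (F.edgeSet.ncard : ℝ) ≤ ((∑ x ∈ X, (nbr G x \ Z').card : ℕ) : ℝ) := by
      exact_mod_cast h1
    have h4 : (X.card : ℝ) * g ≤ X.card * (avgDegree G * r) :=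
      mul_le_mul_of_nonneg_left hg (Nat.cast_nonneg _)
    linarith
  have h := hexp X (by linarith) (by linarith) F hF hFc
  have hN : externalNeighbors (G \ F) (X : Set V) ⊆ ((Z' \ Z) ∪ K : Finset V) := by
    rintro v ⟨hvX, u, hu, huv⟩
    rw [SimpleGraph.sdiff_adj] at huv
    have hvZ' : v ∈ Z' := by
      by_contra hv
      exact huv.2 ⟨huv.1, Or.inl ⟨hu, hv⟩⟩
    simp only [Finset.coe_union, Set.mem_union, Finset.mem_coe, Finset.mem_sdiff]
    by_cases hvZ : v ∈ Z
    · right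
      by_contra hvK
      exact hvX (Finset.mem_coe.2 (Finset.mem_sdiff.2 ⟨hvZ, hvK⟩))
    · exact Or.inl ⟨hvZ', hvZ⟩
  have hNc : ((externalNeighbors (G \ F) (X : Set V)).ncard : ℝ) ≤ (Z' \ Z).card + K.card := by
    have h1 := Set.ncard_le_ncard hN (Finset.finite_toSet _)
    rw [Set.ncard_coe_finset] at h1
    exact_mod_cast h1.trans (Finset.card_union_le _ _)
  have : r * (Z.card / 2) ≤ r * X.card := mul_le_mul_of_nonneg_left hXge hr.le
  linarith

/-- The initial round: the large set `A` is replaced by a subset so small that the union bound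
behind `R` applies to it. A maximal `X` gaining `g` vertices outside `A` per member works, since
otherwise `card_expanding_ge` with Z' = A ∪ N(X) supplies another member. -/
lemma exists_small_expanding_subset {k r g : ℝ} (hexp : ExpandsAtRate G k r) (hk : 0 < k)
    (hr : 0 < r) (hr' : r ≤ 1) (hg0 : 0 < g) (hg : g ≤ avgDegree G * r) {A : Finset V}
    (hkA : k ≤ (A.card : ℝ)) (hAn : (A.card : ℝ) ≤ 2 * (Fintype.card V : ℝ) / 3) :
    ∃ X ⊆ A, g * X.card ≤ ((closedNbrs G X).card : ℝ) ∧
      r * A.card / 4 ≤ ((closedNbrs G X).card : ℝ) := by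
  let P : Finset V → Prop := fun X => X ⊆ A ∧ g * X.card ≤ ((nbrs G X \ A).card : ℝ)
  have h0 : P ∅ := ⟨Finset.empty_subset _, by simp⟩
  obtain ⟨X, -, hmax⟩ := (Set.toFinite {X | P X}).exists_le_maximal h0
  obtain ⟨hXA, hX⟩ := hmax.1
  have hle : ((nbrs G X \ A).card : ℝ) ≤ (closedNbrs G X).card := by
    exact_mod_cast Finset.card_le_card
      (Finset.sdiff_subset.trans (Finset.subset_union_right : nbrs G X ⊆ closedNbrs G X))
  refine ⟨X, hXA, hX.trans hle, le_trans ?_ hle⟩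
  by_contra hcon
  push Not at hcon
  have hsd : (A ∪ nbrs G X) \ A = nbrs G X \ A := by
    ext u
    simp only [Finset.mem_sdiff, Finset.mem_union]
    tauto
  have h1 := card_expanding_ge hexp hk hr hr' hg (Z' := A ∪ nbrs G X) hkA hAn (by rw [hsd]; exact hcon)
  have h2 : (0 : ℝ) < r * A.card / 4 := by
    have : (0 : ℝ) < A.card := by linarith
    positivity
  obtain ⟨z, hz⟩ := Finset.card_pos.1 (by exact_mod_cast h2.trans_le h1)
  obtain ⟨hzA, hzg⟩ := Finset.mem_filter.1 hz
  have hins : nbrs G (insert z X) \ A = (nbrs G X \ A) ∪ (nbr G z \ (A ∪ nbrs G X)) := by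
    ext u
    simp only [Finset.mem_sdiff, Finset.mem_union, mem_nbrs, mem_nbr, Finset.mem_insert,
      exists_eq_or_imp]
    by_cases h : ∃ a ∈ X, G.Adj a u <;> simp only [h] <;> tauto
  have hdisj : Disjoint (nbrs G X \ A) (nbr G z \ (A ∪ nbrs G X)) := by
    rw [Finset.disjoint_left]
    intro u hu hu'
    simp only [Finset.mem_sdiff, Finset.mem_union] at hu hu'
    tauto
  by_cases hzX : z ∈ X
  · have : nbr G z \ (A ∪ nbrs G X) = ∅ := by
      rw [Finset.sdiff_eq_empty_iff_subset]
      intro u hu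
      exact Finset.mem_union_right _ (mem_nbrs.2 ⟨z, hzX, mem_nbr.1 hu⟩)
    rw [this] at hzg
    simp only [Finset.card_empty, Nat.cast_zero] at hzg
    linarith
  · have hP : P (insert z X) := by
      refine ⟨Finset.insert_subset hzA hXA, ?_⟩
      rw [hins, Finset.card_union_of_disjoint hdisj, Finset.card_insert_of_notMem hzX]
      push_cast
      linarith
    exact hzX (hmax.2 hP (Finset.subset_insert _ _) (Finset.mem_insert_self _ _))

lemma ReachableThrough.closedNbrs {A Q X : Finset V} {i : ℕ}
    (h : ∀ z ∈ X, ReachableThrough G A Q i z) {y : V} (hy : y ∈ closedNbrs G X) (hyQ : y ∈ Q) :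
    ReachableThrough G A Q (i + 1) y := by
  rcases mem_closedNbrs.1 hy with hyX | ⟨x, hx, hxy⟩
  · exact (h y hyX).mono (Nat.le_succ i)
  · obtain ⟨a, ha, p, hp, hs⟩ := h x hx
    refine ⟨a, ha, p.concat hxy, ?_, ?_⟩
    · rw [SimpleGraph.Walk.length_concat]
      omega
    · intro u hu
      rw [SimpleGraph.Walk.support_concat, List.mem_append,
        List.mem_singleton] at hu
      rcases hu with hu | rfl
      · exact hs u hu
      · exact Or.inr hyQ

/-- Take a maximal admissible X'. If N[X'] has not grown by the factor 1 + r/4, at least r|N[X]|/4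
vertices of N[X] still have `g` neighbours outside N[X']. A quarter of these lie in R, more than `W`
can block, so one of them can be added to X'. -/
lemma exists_next_round {k r g κ s₀ : ℝ} (hexp : ExpandsAtRate G k r) (hk : 0 < k)
    (hr : 0 < r) (hr' : r ≤ 1) (hg0 : 0 < g) (hg : g ≤ avgDegree G * r)
    (hκg : 24 * κ ≤ r * g) {R W : Finset V}
    (hR : ∀ X X' : Finset V, κ * (X.card + X'.card + 1) ≤ ((expandingPart G g X X').card : ℝ) →
      ((expandingPart G g X X').card : ℝ) / 4 ≤ ((expandingPart G g X X' ∩ R).card : ℝ))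
    (hs₀ : k ≤ s₀) (hW : (W.card : ℝ) < r * s₀ / 16) {X : Finset V}
    (hX : g * X.card ≤ ((closedNbrs G X).card : ℝ))
    (hXs : s₀ ≤ ((closedNbrs G X).card : ℝ))
    (hXn : ((closedNbrs G X).card : ℝ) ≤ 2 * (Fintype.card V : ℝ) / 3) :
    ∃ X' : Finset V, X ⊆ X' ∧ X' ⊆ X ∪ (closedNbrs G X ∩ (R \ W)) ∧
      g * X'.card ≤ ((closedNbrs G X').card : ℝ) ∧
      (1 + r / 4) * (closedNbrs G X).card ≤ ((closedNbrs G X').card : ℝ) := by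
  let P : Finset V → Prop := fun X' => X ⊆ X' ∧ X' ⊆ X ∪ (closedNbrs G X ∩ (R \ W)) ∧
    g * X'.card ≤ ((closedNbrs G X').card : ℝ)
  have h0 : P X := ⟨subset_rfl, Finset.subset_union_left, hX⟩
  obtain ⟨X', -, hmax⟩ := (Set.toFinite {X' | P X'}).exists_le_maximal h0
  obtain ⟨hXX', hX'sub, hX'⟩ := hmax.1
  refine ⟨X', hXX', hX'sub, hX', ?_⟩
  by_contra hcon
  push Not at hcon
  set s : ℝ := ((closedNbrs G X).card : ℝ) with hs
  have hspos : 0 < s := by linarith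
  have hsub := closedNbrs_mono (G := G) hXX'
  have hsd : ((closedNbrs G X' \ closedNbrs G X).card : ℝ) + s = (closedNbrs G X').card := by
    rw [hs]
    exact_mod_cast Finset.card_sdiff_add_card_eq_card hsub
  have h1 : r * s / 4 ≤ ((expandingPart G g X X').card : ℝ) :=
    card_expanding_ge hexp hk hr hr' hg (Z' := closedNbrs G X') (hs₀.trans hXs) hXn (by linarith)
  have hne : X.Nonempty := by
    by_contra hX0
    rw [Finset.not_nonempty_iff_eq_empty] at hX0
    rw [hs, hX0] at hspos
    simp [closedNbrs, nbrs] at hspos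
  have hX1 : (1 : ℝ) ≤ X.card := by exact_mod_cast hne.card_pos
  have hgs : g ≤ s := by nlinarith
  have hrs : r * s ≤ 1 * s := mul_le_mul_of_nonneg_right hr' hspos.le
  -- Here g|X| ≤ s, g|X'| ≤ |N[X']| ≤ 2s and g ≤ s. So the pair (X, X') is cheap enough for the
  -- guarantee on R to apply to its expanding part.
  have h2 : g * (X.card + X'.card + 1) ≤ 5 * s := by
    have : g * (X'.card : ℝ) ≤ 2 * s := by linarith
    linarith
  have h3 : κ * (X.card + X'.card + 1) ≤ r * s / 4 := by
    have h4 : 24 * κ * (X.card + X'.card + 1) ≤ r * g * (X.card + X'.card + 1) :=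
      mul_le_mul_of_nonneg_right hκg (by positivity)
    have h5 : r * (g * (X.card + X'.card + 1)) ≤ r * (5 * s) :=
      mul_le_mul_of_nonneg_left h2 hr.le
    have h6 : 0 < r * s := by positivity
    linarith
  have h4 := hR X X' (h3.trans h1)
  have hrs₀ : r * s₀ ≤ r * s := mul_le_mul_of_nonneg_left hXs hr.le
  have h5 : W.card < (expandingPart G g X X' ∩ R).card := by
    have : (W.card : ℝ) < (expandingPart G g X X' ∩ R).card := by linarith
    exact_mod_cast this
  obtain ⟨z, hz, hzW⟩ := Finset.exists_mem_notMem_of_card_lt_card h5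
  obtain ⟨hz, hzR⟩ := Finset.mem_inter.1 hz
  obtain ⟨hzX, hzg⟩ := Finset.mem_filter.1 hz
  have hzX' : z ∉ X' := by
    intro h
    rw [Finset.sdiff_eq_empty_iff_subset.2 (nbr_subset_closedNbrs h)] at hzg
    simp at hzg
    linarith
  have hP : P (insert z X') := by
    refine ⟨hXX'.trans (Finset.subset_insert _ _), Finset.insert_subset ?_ hX'sub, ?_⟩
    · exact Finset.mem_union_right _
        (Finset.mem_inter.2 ⟨hzX, Finset.mem_sdiff.2 ⟨hzR, hzW⟩⟩)
    · have h6 : (closedNbrs G X' ∪ (nbr G z \ closedNbrs G X')).card ≤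
          (closedNbrs G (insert z X')).card := by
        refine Finset.card_le_card (Finset.union_subset
          (closedNbrs_mono (Finset.subset_insert _ _)) ?_)
        exact Finset.sdiff_subset.trans (nbr_subset_closedNbrs (Finset.mem_insert_self _ _))
      rw [Finset.card_union_of_disjoint Finset.disjoint_sdiff] at h6
      have h7 : ((closedNbrs G X').card : ℝ) + (nbr G z \ closedNbrs G X').card ≤
          (closedNbrs G (insert z X')).card := by exact_mod_cast h6
      rw [Finset.card_insert_of_notMem hzX']
      push_cast
      linarith
  exact hzX' (hmax.2 hP (Finset.subset_insert _ _) (Finset.mem_insert_self _ _))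

/-- The members of X are reached through R \ W, whereas N[X] is unrestricted; it only measures
growth. Beyond 2n/3 the expansion hypothesis no longer applies, and X is kept as it is. -/
lemma exists_reachable_rounds {k r g κ M : ℝ} (hexp : ExpandsAtRate G k r) (hk : 0 < k)
    (hr : 0 < r) (hr' : r ≤ 1) (hg0 : 0 < g) (hg : g ≤ avgDegree G * r)
    (hκg : 24 * κ ≤ r * g) {R W : Finset V}
    (hR : ∀ X X' : Finset V, κ * (X.card + X'.card + 1) ≤ ((expandingPart G g X X').card : ℝ) →
      ((expandingPart G g X X').card : ℝ) / 4 ≤ ((expandingPart G g X X' ∩ R).card : ℝ))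
    (hkM : k ≤ r * M / 4) (hW : (W.card : ℝ) < r * (r * M / 4) / 16) {A : Finset V}
    (hA : (A.card : ℝ) = M) (hAn : (A.card : ℝ) ≤ 2 * (Fintype.card V : ℝ) / 3) (i : ℕ) :
    ∃ X : Finset V, g * X.card ≤ ((closedNbrs G X).card : ℝ) ∧
      r * M / 4 ≤ ((closedNbrs G X).card : ℝ) ∧
      ((1 + r / 4) ^ i * (r * M / 4) ≤ ((closedNbrs G X).card : ℝ) ∨
        2 * (Fintype.card V : ℝ) / 3 < ((closedNbrs G X).card : ℝ)) ∧
      ∀ z ∈ X, ReachableThrough G A (R \ W) i z := by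
  induction i with
  | zero =>
    have hM : 0 ≤ M := hA ▸ Nat.cast_nonneg _
    have hrM : r * M ≤ 1 * M := mul_le_mul_of_nonneg_right hr' hM
    obtain ⟨X, hXA, h1, h2⟩ := exists_small_expanding_subset hexp hk hr hr' hg0 hg
      (A := A) (by linarith) hAn
    rw [hA] at h2
    refine ⟨X, h1, h2, Or.inl (by simpa using h2), fun z hz => ?_⟩
    exact ⟨z, hXA hz, SimpleGraph.Walk.nil, by simp, by simp⟩
  | succ i ih =>
    obtain ⟨X, h1, h2, h3, h4⟩ := ih
    by_cases hn : ((closedNbrs G X).card : ℝ) ≤ 2 * (Fintype.card V : ℝ) / 3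
    · obtain ⟨X', hXX', hX', h5, h6⟩ := exists_next_round hexp hk hr hr' hg0 hg hκg hR hkM hW
        h1 h2 hn
      have hle : ((closedNbrs G X).card : ℝ) ≤ (closedNbrs G X').card := by
        exact_mod_cast Finset.card_le_card (closedNbrs_mono hXX')
      refine ⟨X', h5, h2.trans hle, Or.inl ?_, fun z hz => ?_⟩
      · have h7 := h3.resolve_right (not_lt.2 hn)
        calc (1 + r / 4) ^ (i + 1) * (r * M / 4)
            = (1 + r / 4) * ((1 + r / 4) ^ i * (r * M / 4)) := by ring
          _ ≤ (1 + r / 4) * (closedNbrs G X).card := mul_le_mul_of_nonneg_left h7 (by positivity)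
          _ ≤ _ := h6
      · rcases Finset.mem_union.1 (hX' hz) with hzX | hzX
        · exact (h4 z hzX).mono (Nat.le_succ i)
        · obtain ⟨hz1, hz2⟩ := Finset.mem_inter.1 hzX
          exact ReachableThrough.closedNbrs h4 hz1 hz2
    · exact ⟨X, h1, h2, Or.inr (not_le.1 hn), fun z hz => (h4 z hz).mono (Nat.le_succ i)⟩

/-- Any two large sets are joined by a short walk whose inner vertices are in `R` and avoid a given
small set. -/
def ConnectsLargeSets (G : SimpleGraph V) (R : Finset V) (M ℓ w : ℕ) : Prop :=
  ∀ A B W : Finset V, A.card = M → B.card = M → W.card ≤ w →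
    ∃ a ∈ A, ∃ b ∈ B, ∃ p : G.Walk a b, p.length ≤ ℓ ∧
      ∀ u ∈ p.support, u = a ∨ u = b ∨ u ∈ R \ W

/-- After `i` rounds from either side both closed neighbourhoods exceed 2n/3, so they share n/3
vertices. Some shared vertex lies in R \ W and is one further step away from each side, which gives
length 2i + 2. -/
lemma connectsLargeSets_of_expandsAtRate {k r g κ : ℝ} {M w i : ℕ} (hexp : ExpandsAtRate G k r)
    (hk : 0 < k) (hr : 0 < r) (hr' : r ≤ 1) (hg0 : 0 < g) (hg : g ≤ avgDegree G * r) (hκ : 0 < κ)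
    (hκg : 24 * κ ≤ r * g) {R : Finset V}
    (hR : ∀ X X' : Finset V, κ * (X.card + X'.card + 1) ≤ ((expandingPart G g X X').card : ℝ) →
      ((expandingPart G g X X').card : ℝ) / 4 ≤ ((expandingPart G g X X' ∩ R).card : ℝ))
    (hR' : ∀ X X' : Finset V,
      κ * (X.card + X'.card + 1) ≤ ((closedNbrs G X ∩ closedNbrs G X').card : ℝ) →
      ((closedNbrs G X ∩ closedNbrs G X').card : ℝ) / 4 ≤
        (((closedNbrs G X ∩ closedNbrs G X') ∩ R).card : ℝ))
    (hkM : k ≤ r * M / 4) (hw : (w : ℝ) < r * (r * M / 4) / 16)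
    (hMn : (M : ℝ) ≤ 2 * (Fintype.card V : ℝ) / 3)
    (hi : (Fintype.card V : ℝ) ≤ (1 + r / 4) ^ i * k) :
    ConnectsLargeSets G R M (2 * i + 2) w := by
  intro A B W hA hB hW
  have hWw : (W.card : ℝ) ≤ w := by exact_mod_cast hW
  have hWlt : (W.card : ℝ) < r * (r * M / 4) / 16 := by linarith
  set n : ℝ := (Fintype.card V : ℝ) with hn
  have hn0 : 0 < n := by
    have h1 : (0 : ℝ) < r * M := by linarith
    have h2 : (0 : ℝ) < M := pos_of_mul_pos_right h1 hr.le
    linarith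
  have hbig : ∀ X : Finset V, ((1 + r / 4) ^ i * (r * M / 4) ≤ ((closedNbrs G X).card : ℝ) ∨
      2 * n / 3 < ((closedNbrs G X).card : ℝ)) → 2 * n / 3 < ((closedNbrs G X).card : ℝ) := by
    rintro X (h | h)
    · have h1 : (1 + r / 4) ^ i * k ≤ (1 + r / 4) ^ i * (r * M / 4) :=
        mul_le_mul_of_nonneg_left hkM (by positivity)
      linarith
    · exact h
  obtain ⟨X, hX1, -, hX3, hX4⟩ := exists_reachable_rounds (M := M) hexp hk hr hr' hg0 hg hκg hR
    hkM hWlt (A := A) (by exact_mod_cast hA) (by rw [hA]; exact hMn) i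
  obtain ⟨Y, hY1, -, hY3, hY4⟩ := exists_reachable_rounds (M := M) hexp hk hr hr' hg0 hg hκg hR
    hkM hWlt (A := B) (by exact_mod_cast hB) (by rw [hB]; exact hMn) i
  have hXn := hbig X hX3
  have hYn := hbig Y hY3
  have hle : ∀ Z : Finset V, (Z.card : ℝ) ≤ n := fun Z => by
    rw [hn]; exact_mod_cast Finset.card_le_univ Z
  have hI : n / 3 ≤ ((closedNbrs G X ∩ closedNbrs G Y).card : ℝ) := by
    have h1 : ((closedNbrs G X ∪ closedNbrs G Y).card : ℝ) +
        (closedNbrs G X ∩ closedNbrs G Y).card =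
        (closedNbrs G X).card + (closedNbrs G Y).card := by
      exact_mod_cast Finset.card_union_add_card_inter (closedNbrs G X) (closedNbrs G Y)
    have h2 := hle (closedNbrs G X ∪ closedNbrs G Y)
    linarith
  have hne : X.Nonempty := by
    by_contra hX0
    rw [Finset.not_nonempty_iff_eq_empty] at hX0
    rw [hX0] at hXn
    simp [closedNbrs, nbrs] at hXn
    linarith
  have hX1' : (1 : ℝ) ≤ X.card := by exact_mod_cast hne.card_pos
  have hgn : g ≤ n := by
    have := hle (closedNbrs G X)
    nlinarith
  have hκn : κ * (X.card + Y.card + 1) ≤ n / 3 := by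
    have h1 : g * (X.card + Y.card + 1) ≤ 3 * n := by
      linarith [hle (closedNbrs G X), hle (closedNbrs G Y)]
    have h2 : 24 * κ ≤ 1 * g := hκg.trans (mul_le_mul_of_nonneg_right hr' hg0.le)
    have h3 : 24 * κ * (X.card + Y.card + 1) ≤ 1 * g * (X.card + Y.card + 1) :=
      mul_le_mul_of_nonneg_right h2 (by positivity)
    linarith
  have h1 := hR' X Y (hκn.trans hI)
  have hrM : r * (r * M / 4) ≤ n / 6 := by
    have h2 : r * (M : ℝ) ≤ 1 * M := mul_le_mul_of_nonneg_right hr' (Nat.cast_nonneg _)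
    have h3 : r * (r * M / 4) ≤ 1 * (r * M / 4) :=
      mul_le_mul_of_nonneg_right hr' (by positivity)
    linarith
  have h2 : W.card < ((closedNbrs G X ∩ closedNbrs G Y) ∩ R).card := by
    have : (W.card : ℝ) < ((closedNbrs G X ∩ closedNbrs G Y) ∩ R).card := by linarith
    exact_mod_cast this
  obtain ⟨z, hz, hzW⟩ := Finset.exists_mem_notMem_of_card_lt_card h2
  obtain ⟨hz, hzR⟩ := Finset.mem_inter.1 hz
  obtain ⟨hzX, hzY⟩ := Finset.mem_inter.1 hz
  have hzQ : z ∈ R \ W := Finset.mem_sdiff.2 ⟨hzR, hzW⟩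
  obtain ⟨a, ha, p, hp, hps⟩ := ReachableThrough.closedNbrs hX4 hzX hzQ
  obtain ⟨b, hb, q, hq, hqs⟩ := ReachableThrough.closedNbrs hY4 hzY hzQ
  refine ⟨a, ha, b, hb, p.append q.reverse, ?_, fun u hu => ?_⟩
  · rw [SimpleGraph.Walk.length_append, SimpleGraph.Walk.length_reverse]
    omega
  · rw [SimpleGraph.Walk.mem_support_append_iff, SimpleGraph.Walk.support_reverse,
      List.mem_reverse] at hu
    rcases hu with hu | hu
    · rcases hps u hu with h | h
      · exact Or.inl h
      · exact Or.inr (Or.inr h)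
    · exact Or.inr (hqs u hu)

end Connecting

/-! ### Friedman–Pippenger embedding of binary trees. -/

section Extendability
open scoped Classical
variable {V : Type*} [Fintype V] {G : SimpleGraph V}

/-- The Friedman–Pippenger condition: `Y` is the set of available vertices, every vertex of `Act`
is to have two private children in `Y`, and `T` is the set of children chosen so far, with parent
function `p`. -/
def Extendable (G : SimpleGraph V) (m : ℕ) (Y Act T : Finset V) (p : V → V) : Prop :=
  ∀ X ⊆ Act, X.card ≤ m →
    2 * X.card ≤ (nbrs G X ∩ (Y \ T)).card + (T.filter (fun y => p y ∈ X)).card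

/-- A released child is still a neighbour of its parent, so it moves from the second count to the
first and no set loses. -/
lemma Extendable.restrict {m : ℕ} {Y Act T T' : Finset V} {p : V → V}
    (h : Extendable G m Y Act T p) (hTY : T ⊆ Y) (hadj : ∀ y ∈ T, G.Adj (p y) y) (hT' : T' ⊆ T) :
    Extendable G m Y Act T' p := by
  intro X hX hXm
  refine (h X hX hXm).trans ?_
  have h1 : T.filter (fun y => p y ∈ X) =
      T'.filter (fun y => p y ∈ X) ∪ (T \ T').filter (fun y => p y ∈ X) := by
    rw [← Finset.filter_union, Finset.union_sdiff_of_subset hT']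
  have h2 : (nbrs G X ∩ (Y \ T)) ∪ (T \ T').filter (fun y => p y ∈ X) ⊆
      nbrs G X ∩ (Y \ T') := by
    intro u hu
    simp only [Finset.mem_union, Finset.mem_inter, Finset.mem_sdiff, Finset.mem_filter] at hu ⊢
    rcases hu with ⟨h3, h4, h5⟩ | ⟨⟨h3, h4⟩, h5⟩
    · exact ⟨h3, h4, fun h6 => h5 (hT' h6)⟩
    · exact ⟨mem_nbrs.2 ⟨p u, h5, hadj u h3⟩, hTY h3, h4⟩
  have h3 : Disjoint (nbrs G X ∩ (Y \ T)) ((T \ T').filter (fun y => p y ∈ X)) := by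
    rw [Finset.disjoint_left]
    intro u hu hu'
    simp only [Finset.mem_inter, Finset.mem_sdiff, Finset.mem_filter] at hu hu'
    exact hu.2.2 hu'.1.1
  have h4 := Finset.card_le_card h2
  rw [Finset.card_union_of_disjoint h3] at h4
  have h5 := Finset.card_union_le (T'.filter (fun y => p y ∈ X))
    ((T \ T').filter (fun y => p y ∈ X))
  rw [← h1] at h5
  omega

/-- The right-hand side of the condition is submodular in X, so unions of tight sets are tight. The
strict inequality `hS` at sizes between h and 2h excludes a tight union there, which keeps the size
at most h. -/
lemma tight_union {h : ℕ} {Y Act T : Finset V} {p : V → V}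
    (hE : Extendable G (2 * h) Y Act T p)
    (hS : ∀ X ⊆ Act, h < X.card → X.card ≤ 2 * h → 2 * X.card < (nbrs G X ∩ (Y \ T)).card)
    {A B : Finset V} (hA : A ⊆ Act) (hB : B ⊆ Act) (hAh : A.card ≤ h) (hBh : B.card ≤ h)
    (hAt : (nbrs G A ∩ (Y \ T)).card + (T.filter (fun y => p y ∈ A)).card ≤ 2 * A.card)
    (hBt : (nbrs G B ∩ (Y \ T)).card + (T.filter (fun y => p y ∈ B)).card ≤ 2 * B.card) :
    (A ∪ B).card ≤ h ∧ (nbrs G (A ∪ B) ∩ (Y \ T)).card +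
      (T.filter (fun y => p y ∈ A ∪ B)).card ≤ 2 * (A ∪ B).card := by
  have h1 := Finset.card_union_add_card_inter A B
  have h2 := hE (A ∩ B) (Finset.inter_subset_left.trans hA) (by omega)
  have h3 : (nbrs G (A ∪ B) ∩ (Y \ T)).card + (nbrs G (A ∩ B) ∩ (Y \ T)).card ≤
      (nbrs G A ∩ (Y \ T)).card + (nbrs G B ∩ (Y \ T)).card := by
    rw [← Finset.card_union_add_card_inter (nbrs G A ∩ (Y \ T))]
    refine Nat.add_le_add (Finset.card_le_card ?_) (Finset.card_le_card ?_)
    · intro u hu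
      simp only [Finset.mem_inter, mem_nbrs, Finset.mem_union] at hu ⊢
      obtain ⟨⟨x, hx | hx, hxu⟩, h5⟩ := hu
      · exact Or.inl ⟨⟨x, hx, hxu⟩, h5⟩
      · exact Or.inr ⟨⟨x, hx, hxu⟩, h5⟩
    · intro u hu
      simp only [Finset.mem_inter, mem_nbrs] at hu ⊢
      obtain ⟨⟨x, hx, hxu⟩, h5⟩ := hu
      exact ⟨⟨⟨x, hx.1, hxu⟩, h5⟩, ⟨x, hx.2, hxu⟩, h5⟩
  have h4 : (T.filter (fun y => p y ∈ A ∪ B)).card + (T.filter (fun y => p y ∈ A ∩ B)).card =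
      (T.filter (fun y => p y ∈ A)).card + (T.filter (fun y => p y ∈ B)).card := by
    rw [← Finset.card_union_add_card_inter (T.filter (fun y => p y ∈ A)), ← Finset.filter_or,
      ← Finset.filter_and]
    simp only [Finset.mem_union, Finset.mem_inter]
  have h5 : (nbrs G (A ∪ B) ∩ (Y \ T)).card +
      (T.filter (fun y => p y ∈ A ∪ B)).card ≤ 2 * (A ∪ B).card := by omega
  refine ⟨?_, h5⟩
  by_contra h6
  have := hS (A ∪ B) (Finset.union_subset hA hB) (not_le.1 h6) (by omega)
  omega

/-- If no choice works, each available neighbour y of x is blocked by a tight set that avoids x and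
has y as a neighbour. Their union U is tight, and adding x to it gives no new available neighbour
and fewer than two children, against the condition for U ∪ {x}. -/
lemma Extendable.exists_child {h : ℕ} (hh : 1 ≤ h) {Y Act T : Finset V} {p : V → V}
    (hE : Extendable G (2 * h) Y Act T p)
    (hS : ∀ X ⊆ Act, h < X.card → X.card ≤ 2 * h → 2 * X.card < (nbrs G X ∩ (Y \ T)).card)
    {x : V} (hx : x ∈ Act) (hdeg : (T.filter (fun y => p y = x)).card < 2) :
    ∃ y ∈ Y \ T, G.Adj x y ∧
      Extendable G (2 * h) Y Act (insert y T) (Function.update p y x) := by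
  by_contra hcon
  push Not at hcon
  have hblock : ∀ y ∈ nbr G x ∩ (Y \ T), ∃ X ⊆ Act, X.card ≤ h ∧ x ∉ X ∧ y ∈ nbrs G X ∧
      (nbrs G X ∩ (Y \ T)).card + (T.filter (fun y => p y ∈ X)).card ≤ 2 * X.card := by
    intro y hy
    obtain ⟨hxy, hyY⟩ := Finset.mem_inter.1 hy
    have hyT := (Finset.mem_sdiff.1 hyY).2
    have h1 := hcon y hyY (mem_nbr.1 hxy)
    unfold Extendable at h1
    push Not at h1
    obtain ⟨X, hX, hXc, hlt⟩ := h1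
    have h2 := hE X hX hXc
    have h3 : (insert y T).filter (fun z => Function.update p y x z ∈ X) =
        if x ∈ X then insert y (T.filter (fun z => p z ∈ X)) else T.filter (fun z => p z ∈ X) := by
      rw [Finset.filter_insert, Function.update_self]
      have : T.filter (fun z => Function.update p y x z ∈ X) = T.filter (fun z => p z ∈ X) := by
        refine Finset.filter_congr fun z hz => ?_
        rw [Function.update_of_ne]
        rintro rfl
        exact hyT hz
      rw [this]
    have h4 : nbrs G X ∩ (Y \ T) ⊆ insert y (nbrs G X ∩ (Y \ insert y T)) := by
      intro u hu
      simp only [Finset.mem_inter, Finset.mem_sdiff, Finset.mem_insert] at hu ⊢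
      tauto
    have h5 := (Finset.card_le_card h4).trans (Finset.card_insert_le _ _)
    rw [h3] at hlt
    have hxX : x ∉ X := by
      intro hxX
      rw [if_pos hxX, Finset.card_insert_of_notMem (by simp [hyT])] at hlt
      omega
    rw [if_neg hxX] at hlt
    have hyX : y ∈ nbrs G X := by
      by_contra hyX
      have h6 : nbrs G X ∩ (Y \ T) ⊆ nbrs G X ∩ (Y \ insert y T) := by
        intro u hu
        simp only [Finset.mem_inter, Finset.mem_sdiff, Finset.mem_insert] at hu ⊢
        refine ⟨hu.1, hu.2.1, ?_⟩
        rintro (rfl | h7)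
        · exact hyX hu.1
        · exact hu.2.2 h7
      have := Finset.card_le_card h6
      omega
    have htight : (nbrs G X ∩ (Y \ T)).card + (T.filter (fun y => p y ∈ X)).card ≤ 2 * X.card := by
      omega
    refine ⟨X, hX, ?_, hxX, hyX, htight⟩
    by_contra h6
    have := hS X hX (not_le.1 h6) hXc
    omega
  choose! X hXA hXh hxX hyX hXt using hblock
  have hunion : ∀ D ⊆ nbr G x ∩ (Y \ T), (D.biUnion X) ⊆ Act ∧ (D.biUnion X).card ≤ h ∧
      (nbrs G (D.biUnion X) ∩ (Y \ T)).card + (T.filter (fun y => p y ∈ D.biUnion X)).card ≤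
        2 * (D.biUnion X).card := by
    intro D
    induction D using Finset.induction_on with
    | empty =>
      intro _
      simp [nbrs]
    | insert y D _ ih =>
      intro hD
      obtain ⟨h1, h2, h3⟩ := ih ((Finset.subset_insert _ _).trans hD)
      have hy := hD (Finset.mem_insert_self y D)
      rw [Finset.biUnion_insert]
      exact ⟨Finset.union_subset (hXA y hy) h1,
        tight_union hE hS (hXA y hy) h1 (hXh y hy) h2 (hXt y hy) h3⟩
  obtain ⟨h1, h2, h3⟩ := hunion _ subset_rfl
  set U := (nbr G x ∩ (Y \ T)).biUnion X with hU
  have hxU : x ∉ U := by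
    rw [hU, Finset.mem_biUnion]
    rintro ⟨y, hy, hxy⟩
    exact hxX y hy hxy
  have h4 := hE (insert x U) (Finset.insert_subset hx h1)
    (by rw [Finset.card_insert_of_notMem hxU]; omega)
  have h5 : nbrs G (insert x U) ∩ (Y \ T) ⊆ nbrs G U ∩ (Y \ T) := by
    intro u hu
    obtain ⟨hu1, hu2⟩ := Finset.mem_inter.1 hu
    refine Finset.mem_inter.2 ⟨?_, hu2⟩
    obtain ⟨z, hz, hzu⟩ := mem_nbrs.1 hu1
    rcases Finset.mem_insert.1 hz with rfl | hz
    · have hux : u ∈ nbr G z ∩ (Y \ T) := Finset.mem_inter.2 ⟨mem_nbr.2 hzu, hu2⟩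
      exact nbrs_mono (Finset.subset_biUnion_of_mem X hux) (hyX u hux)
    · exact mem_nbrs.2 ⟨z, hz, hzu⟩
  have h6 : T.filter (fun y => p y ∈ insert x U) ⊆
      T.filter (fun y => p y = x) ∪ T.filter (fun y => p y ∈ U) := by
    intro u hu
    simp only [Finset.mem_filter, Finset.mem_insert, Finset.mem_union] at hu ⊢
    tauto
  have h7 := Finset.card_le_card h5
  have h8 := (Finset.card_le_card h6).trans (Finset.card_union_le _ _)
  rw [Finset.card_insert_of_notMem hxU] at h4
  omega

/-- The chosen vertices `T` form a forest: each is joined to its parent, which is not available any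
more. -/
structure IsParentForest (G : SimpleGraph V) (Y T : Finset V) (p : V → V) : Prop where
  subset : T ⊆ Y
  adj : ∀ y ∈ T, G.Adj (p y) y
  closed : ∀ y ∈ T, p y ∉ Y \ T

lemma Extendable.exists_level {h : ℕ} (hh : 1 ≤ h) {Y Act T : Finset V} {p : V → V}
    (hE : Extendable G (2 * h) Y Act T p)
    (hS : ∀ X ⊆ Act, h < X.card → X.card ≤ 2 * h → 8 * X.card ≤ (nbrs G X ∩ Y).card + h)
    (hF : IsParentForest G Y T p) (L : Finset V) (hL : L ⊆ Act) (hLY : ∀ x ∈ L, x ∉ Y \ T)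
    (hchild : ∀ x ∈ L, ∀ y ∈ T, p y ≠ x) (hcard : T.card + 2 * L.card ≤ 5 * h) :
    ∃ (T' : Finset V) (p' : V → V), T ⊆ T' ∧ Extendable G (2 * h) Y Act T' p' ∧
      IsParentForest G Y T' p' ∧ T'.card = T.card + 2 * L.card ∧ (∀ y ∈ T, p' y = p y) ∧
      ∀ y ∈ T' \ T, p' y ∈ L := by
  -- The budget 5h is what eightfold expansion affords: 8|X| - h - 5h > 2|X| as soon as |X| > h.
  have hslack : ∀ T' : Finset V, T'.card ≤ 5 * h → ∀ X ⊆ Act, h < X.card → X.card ≤ 2 * h →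
      2 * X.card < (nbrs G X ∩ (Y \ T')).card := by
    intro T' hT' X hX h1 h2
    have h3 := hS X hX h1 h2
    have h4 : nbrs G X ∩ Y ⊆ (nbrs G X ∩ (Y \ T')) ∪ T' := by
      intro u hu
      simp only [Finset.mem_inter, Finset.mem_union, Finset.mem_sdiff] at hu ⊢
      tauto
    have h5 := (Finset.card_le_card h4).trans (Finset.card_union_le _ _)
    omega
  induction L using Finset.induction_on with
  | empty => exact ⟨T, p, subset_rfl, hE, hF, by simp, fun _ _ => rfl, by simp⟩
  | insert x L hxL ih =>
    rw [Finset.card_insert_of_notMem hxL] at hcard ⊢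
    obtain ⟨T₁, p₁, h1, h2, h3, h4, h5, h6⟩ := ih ((Finset.subset_insert _ _).trans hL)
      (fun z hz => hLY z (Finset.mem_insert_of_mem hz))
      (fun z hz => hchild z (Finset.mem_insert_of_mem hz)) (by omega)
    have hxAct : x ∈ Act := hL (Finset.mem_insert_self _ _)
    have hno : T₁.filter (fun y => p₁ y = x) = ∅ := by
      rw [Finset.filter_eq_empty_iff]
      intro y hy hyx
      by_cases hyT : y ∈ T
      · rw [h5 y hyT] at hyx
        exact hchild x (Finset.mem_insert_self _ _) y hyT hyx
      · exact hxL (hyx ▸ h6 y (Finset.mem_sdiff.2 ⟨hy, hyT⟩))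
    have hxT : x ∉ Y \ T := hLY x (Finset.mem_insert_self _ _)
    obtain ⟨y₁, hy₁, ha₁, hE₁⟩ := h2.exists_child hh (hslack T₁ (by omega)) hxAct
      (by rw [hno]; simp)
    set p₂ := Function.update p₁ y₁ x with hp₂
    have hy₁' := Finset.mem_sdiff.1 hy₁
    have hp₂T : ∀ y ∈ T₁, p₂ y = p₁ y := fun y hy =>
      Function.update_of_ne (fun h => hy₁'.2 (by rwa [← h])) _ _
    have hp₂y : p₂ y₁ = x := Function.update_self _ _ _
    have hone : ((insert y₁ T₁).filter (fun y => p₂ y = x)).card < 2 := by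
      refine lt_of_le_of_lt (Finset.card_le_card (t := {y₁}) ?_) (by simp)
      intro y hy
      obtain ⟨hy1, hy2⟩ := Finset.mem_filter.1 hy
      rcases Finset.mem_insert.1 hy1 with rfl | hy1
      · simp
      · rw [hp₂T y hy1] at hy2
        have : y ∈ T₁.filter (fun y => p₁ y = x) := Finset.mem_filter.2 ⟨hy1, hy2⟩
        rw [hno] at this
        simp at this
    have hc₂ : (insert y₁ T₁).card = T₁.card + 1 := Finset.card_insert_of_notMem hy₁'.2
    obtain ⟨y₂, hy₂, ha₂, hE₂⟩ := hE₁.exists_child hh (hslack _ (by omega)) hxAct hone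
    set p₃ := Function.update p₂ y₂ x with hp₃
    have hy₂' := Finset.mem_sdiff.1 hy₂
    have hp₃T : ∀ y ∈ insert y₁ T₁, p₃ y = p₂ y := fun y hy =>
      Function.update_of_ne (fun h => hy₂'.2 (by rwa [← h])) _ _
    have hp₃y : p₃ y₂ = x := Function.update_self _ _ _
    have hsub : T ⊆ insert y₂ (insert y₁ T₁) :=
      h1.trans ((Finset.subset_insert _ _).trans (Finset.subset_insert _ _))
    have hcases : ∀ y ∈ insert y₂ (insert y₁ T₁), (y ∈ T₁ ∧ p₃ y = p₁ y) ∨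
        (p₃ y = x ∧ G.Adj x y) := by
      intro y hy
      rcases Finset.mem_insert.1 hy with rfl | hy
      · exact Or.inr ⟨hp₃y, ha₂⟩
      · rcases Finset.mem_insert.1 hy with rfl | hy'
        · exact Or.inr ⟨(hp₃T _ hy).trans hp₂y, ha₁⟩
        · exact Or.inl ⟨hy', (hp₃T y hy).trans (hp₂T y hy')⟩
    refine ⟨insert y₂ (insert y₁ T₁), p₃, hsub, hE₂, ⟨?_, ?_, ?_⟩, ?_, ?_, ?_⟩
    · exact Finset.insert_subset hy₂'.1 (Finset.insert_subset hy₁'.1 h3.subset)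
    · intro y hy
      rcases hcases y hy with ⟨h7, h8⟩ | ⟨h7, h8⟩
      · rw [h8]; exact h3.adj y h7
      · rw [h7]; exact h8
    · intro y hy hyY
      obtain ⟨h9, h10⟩ := Finset.mem_sdiff.1 hyY
      rcases hcases y hy with ⟨h7, h8⟩ | ⟨h7, h8⟩
      · rw [h8] at h9 h10
        exact h3.closed y h7 (Finset.mem_sdiff.2 ⟨h9, fun h11 =>
          h10 (Finset.mem_insert_of_mem (Finset.mem_insert_of_mem h11))⟩)
      · rw [h7] at h9 h10
        exact hxT (Finset.mem_sdiff.2 ⟨h9, fun h11 => h10 (hsub h11)⟩)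
    · rw [Finset.card_insert_of_notMem hy₂'.2, hc₂, h4]
      ring
    · intro y hy
      rw [hp₃T y (Finset.mem_insert_of_mem (h1 hy)), hp₂T y (h1 hy), h5 y hy]
    · intro y hy
      obtain ⟨hy, hyT⟩ := Finset.mem_sdiff.1 hy
      rcases hcases y hy with ⟨h7, h8⟩ | ⟨h7, _⟩
      · rw [h8]
        exact Finset.mem_insert_of_mem (h6 y (Finset.mem_sdiff.2 ⟨h7, hyT⟩))
      · rw [h7]
        exact Finset.mem_insert_self _ _

/-- `v` is the end of a walk from `x` with inner vertices in a set `P ⊆ Q` of at most `j` vertices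
that contains the parents other than `x` of its members. -/
def HasBranch (G : SimpleGraph V) (p : V → V) (Q : Finset V) (j : ℕ) (x v : V) : Prop :=
  ∃ P ⊆ Q, P.card ≤ j ∧ (∀ y ∈ P, p y ∈ insert x P) ∧
    ∃ q : G.Walk x v, ∀ u ∈ q.support, u ∈ insert x P

/-- The tree has 2^(j+1) - 2 vertices besides its root, and the last level is childless, so it can
be extended again. Branches are closed under taking parents so that one of them can later be kept
while the rest of the tree is released. -/
lemma Extendable.exists_tree {h : ℕ} (hh : 1 ≤ h) {Y Act T : Finset V} {p : V → V}
    (hE : Extendable G (2 * h) Y Act T p)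
    (hS : ∀ X ⊆ Act, h < X.card → X.card ≤ 2 * h → 8 * X.card ≤ (nbrs G X ∩ Y).card + h)
    (hF : IsParentForest G Y T p) (hY : Y ⊆ Act) {x : V} (hx : x ∈ Act) (hxY : x ∉ Y)
    (hchild : ∀ y ∈ T, p y ≠ x) (j : ℕ) (hcard : T.card + 2 ^ (j + 1) ≤ 5 * h) :
    ∃ (T' : Finset V) (p' : V → V) (L : Finset V), T ⊆ T' ∧ Extendable G (2 * h) Y Act T' p' ∧
      IsParentForest G Y T' p' ∧ (∀ y ∈ T, p' y = p y) ∧ T'.card + 2 = T.card + 2 ^ (j + 1) ∧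
      (∀ y ∈ T' \ T, p' y ∈ insert x T') ∧ L.card = 2 ^ j ∧ L ⊆ insert x T' ∧
      (∀ v ∈ L, ∀ y ∈ T', p' y ≠ v) ∧ ∀ v ∈ L, HasBranch G p' (T' \ T) j x v := by
  induction j with
  | zero =>
    refine ⟨T, p, {x}, subset_rfl, hE, hF, fun _ _ => rfl, by simp, by simp, by simp, by simp,
      ?_, ?_⟩
    · intro v hv y hy
      rw [Finset.mem_singleton.1 hv]
      exact hchild y hy
    · intro v hv
      rw [Finset.mem_singleton.1 hv]
      exact ⟨∅, by simp, by simp, by simp, SimpleGraph.Walk.nil, by simp⟩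
  | succ j ih =>
    have hpow : 2 ^ (j + 1 + 1) = 2 * 2 ^ (j + 1) := by ring
    have hpow' : 2 ^ (j + 1) = 2 * 2 ^ j := by ring
    obtain ⟨T₁, p₁, L, h1, h2, h3, h4, h5, h6, h7, h8, h9, h10⟩ := ih (by omega)
    have hLAct : L ⊆ Act := h8.trans (Finset.insert_subset hx (h3.subset.trans hY))
    have hLT : ∀ v ∈ L, v ∉ Y \ T₁ := by
      intro v hv hvY
      obtain ⟨h11, h12⟩ := Finset.mem_sdiff.1 hvY
      rcases Finset.mem_insert.1 (h8 hv) with rfl | h13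
      · exact hxY h11
      · exact h12 h13
    obtain ⟨T₂, p₂, k1, k2, k3, k4, k5, k6⟩ := h2.exists_level hh hS h3 L hLAct hLT h9 (by omega)
    refine ⟨T₂, p₂, T₂ \ T₁, h1.trans k1, k2, k3, fun y hy => (k5 y (h1 hy)).trans (h4 y hy),
      by omega, ?_, ?_, ?_, ?_, ?_⟩
    · intro y hy
      obtain ⟨hy, hyT⟩ := Finset.mem_sdiff.1 hy
      refine Finset.insert_subset_insert x k1 ?_
      by_cases hy1 : y ∈ T₁
      · rw [k5 y hy1]
        exact h6 y (Finset.mem_sdiff.2 ⟨hy1, hyT⟩)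
      · exact h8 (k6 y (Finset.mem_sdiff.2 ⟨hy, hy1⟩))
    · have := Finset.card_sdiff_add_card_eq_card k1
      omega
    · exact Finset.sdiff_subset.trans (Finset.subset_insert _ _)
    · rintro v hv y hy rfl
      obtain ⟨hv1, hv2⟩ := Finset.mem_sdiff.1 hv
      have hvY : p₂ y ∈ Y \ T₁ := Finset.mem_sdiff.2 ⟨k3.subset hv1, hv2⟩
      by_cases hy1 : y ∈ T₁
      · rw [k5 y hy1] at hvY
        exact h3.closed y hy1 hvY
      · exact hLT _ (k6 y (Finset.mem_sdiff.2 ⟨hy, hy1⟩)) hvY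
    · intro v hv
      have hvL := k6 v hv
      obtain ⟨hv1, hv2⟩ := Finset.mem_sdiff.1 hv
      obtain ⟨P, hP1, hP2, hP3, q, hq⟩ := h10 _ hvL
      refine ⟨insert v P, ?_, ?_, ?_, q.concat (k3.adj v hv1), ?_⟩
      · refine Finset.insert_subset (Finset.mem_sdiff.2 ⟨hv1, fun h => hv2 (h1 h)⟩) ?_
        exact hP1.trans (Finset.sdiff_subset_sdiff k1 subset_rfl)
      · exact (Finset.card_insert_le _ _).trans (by omega)
      · intro y hy
        refine Finset.insert_subset_insert x (Finset.subset_insert v P) ?_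
        rcases Finset.mem_insert.1 hy with rfl | hy
        · exact hq _ q.end_mem_support
        · rw [k5 y (Finset.mem_sdiff.1 (hP1 hy)).1]
          exact hP3 y hy
      · intro u hu
        rw [SimpleGraph.Walk.support_concat, List.mem_append, List.mem_singleton] at hu
        rcases hu with hu | rfl
        · exact Finset.insert_subset_insert x (Finset.subset_insert v P) (hq u hu)
        · simp

end Extendability

/-! ### Linking many pairs of terminals. -/

section Linking
open scoped Classical
variable {V : Type*} [Fintype V] {G : SimpleGraph V}

lemma Extendable.mono_active {m : ℕ} {Y Act Act' T : Finset V} {p : V → V}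
    (h : Extendable G m Y Act T p) (hA : Act' ⊆ Act) : Extendable G m Y Act' T p :=
  fun X hX hXm => h X (hX.trans hA) hXm

/-- Two full binary trees provide bottom levels large enough to be connected through R; then
everything except the two used branches P is released. Making s, t and P inactive restores an
extendable state with no chosen children. -/
lemma Extendable.link_pair {h J ℓ w : ℕ} (hh : 1 ≤ h) (hJ : 2 ^ J ≤ h) {Y Act R W : Finset V}
    (hE : Extendable G (2 * h) Y Act ∅ id)
    (hS : ∀ X ⊆ Act, h < X.card → X.card ≤ 2 * h → 8 * X.card ≤ (nbrs G X ∩ Y).card + h)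
    (hY : Y ⊆ Act) {s t : V} (hs : s ∈ Act) (ht : t ∈ Act) (hsY : s ∉ Y) (htY : t ∉ Y)
    (hst : s ≠ t) (hC : ConnectsLargeSets G R (2 ^ J) ℓ w) (hW : W.card ≤ w) :
    ∃ P ⊆ Y, ∃ Q ⊆ R \ W, P.card ≤ 2 * J ∧ Q.card ≤ ℓ + 1 ∧
      (∃ q : G.Walk s t, ∀ u ∈ q.support, u = s ∨ u = t ∨ u ∈ P ∨ u ∈ Q) ∧
      Extendable G (2 * h) (Y \ P) (Act \ insert s (insert t P)) ∅ id := by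
  have hpow : 2 ^ (J + 1) = 2 * 2 ^ J := by ring
  obtain ⟨T₁, p₁, A, -, a2, a3, -, a5, a6, a7, -, -, a10⟩ := hE.exists_tree hh hS
    ⟨Finset.empty_subset _, by simp, by simp⟩ hY hs hsY (by simp) J (by simp; omega)
  rw [Finset.card_empty] at a5
  rw [Finset.sdiff_empty] at a6
  have ht1 : ∀ y ∈ T₁, p₁ y ≠ t := by
    rintro y hy rfl
    rcases Finset.mem_insert.1 (a6 y hy) with h1 | h1
    · exact hst h1.symm
    · exact htY (a3.subset h1)
  obtain ⟨T₂, p₂, B, b1, b2, b3, b4, -, -, b7, -, -, b10⟩ := a2.exists_tree hh hS a3 hY ht htY ht1 J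
    (by omega)
  obtain ⟨a, ha, b, hb, q, hq, hqs⟩ := hC A B W a7 b7 hW
  obtain ⟨P, hP1, hP2, hP3, qa, hqa⟩ := a10 a ha
  obtain ⟨P', hP'1, hP'2, hP'3, qb, hqb⟩ := b10 b hb
  rw [Finset.sdiff_empty] at hP1
  have hPP : P ∪ P' ⊆ T₂ :=
    Finset.union_subset (hP1.trans b1) (hP'1.trans Finset.sdiff_subset)
  refine ⟨P ∪ P', hPP.trans b3.subset, q.support.toFinset ∩ (R \ W), Finset.inter_subset_right,
    ?_, ?_, ⟨(qa.append q).append qb.reverse, ?_⟩, ?_⟩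
  · exact (Finset.card_union_le _ _).trans (by omega)
  · refine (Finset.card_le_card Finset.inter_subset_left).trans
      ((List.toFinset_card_le _).trans ?_)
    rw [SimpleGraph.Walk.length_support]
    omega
  · intro u hu
    have hqa' : ∀ u ∈ qa.support, u = s ∨ u = t ∨ u ∈ P ∪ P' ∨ u ∈ q.support.toFinset ∩ (R \ W) := by
      intro u hu
      rcases Finset.mem_insert.1 (hqa u hu) with h1 | h1
      · exact Or.inl h1
      · exact Or.inr (Or.inr (Or.inl (Finset.mem_union_left _ h1)))
    have hqb' : ∀ u ∈ qb.support, u = s ∨ u = t ∨ u ∈ P ∪ P' ∨ u ∈ q.support.toFinset ∩ (R \ W) := by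
      intro u hu
      rcases Finset.mem_insert.1 (hqb u hu) with h1 | h1
      · exact Or.inr (Or.inl h1)
      · exact Or.inr (Or.inr (Or.inl (Finset.mem_union_right _ h1)))
    rw [SimpleGraph.Walk.mem_support_append_iff, SimpleGraph.Walk.mem_support_append_iff,
      SimpleGraph.Walk.support_reverse, List.mem_reverse] at hu
    rcases hu with (hu | hu) | hu
    · exact hqa' u hu
    · rcases hqs u hu with rfl | rfl | h1
      · exact hqa' _ qa.end_mem_support
      · exact hqb' _ qb.end_mem_support
      · exact Or.inr (Or.inr (Or.inr (Finset.mem_inter.2 ⟨List.mem_toFinset.2 hu, h1⟩)))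
    · exact hqb' u hu
  · intro X hX hXm
    have h1 := b2.restrict b3.subset b3.adj hPP X (hX.trans Finset.sdiff_subset) hXm
    -- Parents of kept vertices are s, t or kept vertices, all inactive now, so no active set owes
    -- its bound to kept children.
    have h2 : (P ∪ P').filter (fun y => p₂ y ∈ X) = ∅ := by
      rw [Finset.filter_eq_empty_iff]
      intro y hy hyX
      have h3 := (Finset.mem_sdiff.1 (hX hyX)).2
      simp only [Finset.mem_insert, Finset.mem_union, not_or] at h3
      rcases Finset.mem_union.1 hy with hy | hy
      · have h4 := hP3 y hy
        rw [← b4 y (hP1 hy)] at h4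
        rcases Finset.mem_insert.1 h4 with h4 | h4
        · exact h3.1 h4
        · exact h3.2.2.1 h4
      · rcases Finset.mem_insert.1 (hP'3 y hy) with h4 | h4
        · exact h3.2.1 h4
        · exact h3.2.2.2 h4
    rw [h2] at h1
    simpa using h1

/-- Pairs of terminals can be linked by vertex-disjoint walks if small sets expand into `Y` and
large sets are connected through `R`. -/
lemma exists_disjoint_linking {ι : Type*} [Fintype ι] {h J ℓ w : ℕ} (hh : 1 ≤ h) (hJ : 2 ^ J ≤ h)
    {Y R : Finset V} (s t : ι → V) (hsY : ∀ i, s i ∉ Y) (htY : ∀ i, t i ∉ Y)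
    (hss : Function.Injective s) (htt : Function.Injective t) (hst : ∀ i j, s i ≠ t j)
    (hexp : ∀ X ⊆ Y ∪ (Finset.univ.image s ∪ Finset.univ.image t), X.card ≤ 2 * h →
      8 * X.card ≤ (nbrs G X ∩ Y).card)
    (hC : ConnectsLargeSets G R (2 ^ J) ℓ w) (hι : Fintype.card ι * (2 * J) ≤ h)
    (hw : Fintype.card ι * (ℓ + 1) ≤ w) :
    ∃ P Q : ι → Finset V, (∀ i, P i ⊆ Y) ∧ (∀ i, Q i ⊆ R) ∧
      (∀ i j, i ≠ j → Disjoint (P i) (P j)) ∧ (∀ i j, i ≠ j → Disjoint (Q i) (Q j)) ∧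
      ∀ i, ∃ q : G.Walk (s i) (t i), ∀ u ∈ q.support,
        u = s i ∨ u = t i ∨ u ∈ P i ∨ u ∈ Q i := by
  -- Link the pairs one at a time. The active vertices are the unused part of Y and the terminals of
  -- the pairs still to be linked.
  have key : ∀ E : Finset ι, ∃ P Q : ι → Finset V, (∀ i, P i ⊆ Y) ∧ (∀ i, Q i ⊆ R) ∧
      (∀ i ∈ E, ∀ j ∈ E, i ≠ j → Disjoint (P i) (P j)) ∧
      (∀ i ∈ E, ∀ j ∈ E, i ≠ j → Disjoint (Q i) (Q j)) ∧
      (E.biUnion P).card ≤ E.card * (2 * J) ∧ (E.biUnion Q).card ≤ E.card * (ℓ + 1) ∧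
      Extendable G (2 * h) (Y \ E.biUnion P)
        ((Y \ E.biUnion P) ∪ (Eᶜ.image s ∪ Eᶜ.image t)) ∅ id ∧
      ∀ i ∈ E, ∃ q : G.Walk (s i) (t i), ∀ u ∈ q.support,
        u = s i ∨ u = t i ∨ u ∈ P i ∨ u ∈ Q i := by
    intro E
    induction E using Finset.induction_on with
    | empty =>
      refine ⟨fun _ => ∅, fun _ => ∅, by simp, by simp, by simp, by simp, by simp, by simp, ?_,
        by simp⟩
      intro X hX hXm
      simp only [Finset.biUnion_empty, Finset.sdiff_empty, Finset.compl_empty] at hX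
      have := hexp X hX hXm
      simp only [Finset.biUnion_empty, Finset.sdiff_empty]
      omega
    | insert i E hi ih =>
      obtain ⟨P, Q, h1, h2, h3, h4, h5, h6, h7, h8⟩ := ih
      have hEc : E.card + 1 ≤ Fintype.card ι := by
        rw [← Finset.card_insert_of_notMem hi]
        exact Finset.card_le_univ _
      have hPc : (E.biUnion P).card ≤ h :=
        h5.trans ((Nat.mul_le_mul_right _ (by omega)).trans hι)
      have hQc : (E.biUnion Q).card ≤ w :=
        h6.trans ((Nat.mul_le_mul_right _ (by omega)).trans hw)
      set Act := (Y \ E.biUnion P) ∪ (Eᶜ.image s ∪ Eᶜ.image t) with hAct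
      have hActs : Act ⊆ Y ∪ (Finset.univ.image s ∪ Finset.univ.image t) :=
        Finset.union_subset_union Finset.sdiff_subset (Finset.union_subset_union
          (Finset.image_subset_image (Finset.subset_univ _))
          (Finset.image_subset_image (Finset.subset_univ _)))
      -- The branches kept so far have at most h vertices in total, which is the additive loss
      -- allowed for.
      have hS : ∀ X ⊆ Act, h < X.card → X.card ≤ 2 * h →
          8 * X.card ≤ (nbrs G X ∩ (Y \ E.biUnion P)).card + h := by
        intro X hX _ hXm
        have h9 := hexp X (hX.trans hActs) hXm
        have h10 : nbrs G X ∩ Y ⊆ (nbrs G X ∩ (Y \ E.biUnion P)) ∪ E.biUnion P := by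
          intro u hu
          rw [Finset.mem_inter] at hu
          by_cases huP : u ∈ E.biUnion P
          · exact Finset.mem_union_right _ huP
          · exact Finset.mem_union_left _
              (Finset.mem_inter.2 ⟨hu.1, Finset.mem_sdiff.2 ⟨hu.2, huP⟩⟩)
        have h11 := (Finset.card_le_card h10).trans (Finset.card_union_le _ _)
        omega
      have hiE : i ∈ Eᶜ := Finset.mem_compl.2 hi
      obtain ⟨P₀, hP₀, Q₀, hQ₀, c1, c2, c3, c4⟩ := h7.link_pair (R := R) (W := E.biUnion Q) hh hJ hS
        Finset.subset_union_left
        (Finset.mem_union_right _ (Finset.mem_union_left _ (Finset.mem_image_of_mem s hiE)))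
        (Finset.mem_union_right _ (Finset.mem_union_right _ (Finset.mem_image_of_mem t hiE)))
        (fun h9 => hsY i (Finset.sdiff_subset h9)) (fun h9 => htY i (Finset.sdiff_subset h9))
        (hst i i) hC hQc
      have hPi : Function.update P i P₀ i = P₀ := Function.update_self _ _ _
      have hQi : Function.update Q i Q₀ i = Q₀ := Function.update_self _ _ _
      have hPj : ∀ j, j ≠ i → Function.update P i P₀ j = P j := fun j hj =>
        Function.update_of_ne hj _ _
      have hQj : ∀ j, j ≠ i → Function.update Q i Q₀ j = Q j := fun j hj =>
        Function.update_of_ne hj _ _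
      have hne : ∀ j ∈ E, j ≠ i := fun j hj hji => hi (hji ▸ hj)
      have hPU : (insert i E).biUnion (Function.update P i P₀) = P₀ ∪ E.biUnion P := by
        rw [Finset.biUnion_insert, hPi]
        congr 1
        exact Finset.biUnion_congr rfl fun j hj => hPj j (hne j hj)
      have hQU : (insert i E).biUnion (Function.update Q i Q₀) = Q₀ ∪ E.biUnion Q := by
        rw [Finset.biUnion_insert, hQi]
        congr 1
        exact Finset.biUnion_congr rfl fun j hj => hQj j (hne j hj)
      have hP₀d : ∀ j ∈ E, Disjoint P₀ (P j) := fun j hj =>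
        (disjoint_sdiff_self_left.mono_left hP₀).mono_right
          (Finset.subset_biUnion_of_mem P hj)
      have hQ₀d : ∀ j ∈ E, Disjoint Q₀ (Q j) := fun j hj =>
        (disjoint_sdiff_self_left.mono_left hQ₀).mono_right
          (Finset.subset_biUnion_of_mem Q hj)
      refine ⟨Function.update P i P₀, Function.update Q i Q₀, ?_, ?_, ?_, ?_, ?_, ?_, ?_, ?_⟩
      · intro j
        by_cases hj : j = i
        · subst hj
          rw [hPi]
          exact hP₀.trans Finset.sdiff_subset
        · rw [hPj j hj]
          exact h1 j
      · intro j
        by_cases hj : j = i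
        · subst hj
          rw [hQi]
          exact hQ₀.trans Finset.sdiff_subset
        · rw [hQj j hj]
          exact h2 j
      · intro a ha b hb hab
        rcases Finset.mem_insert.1 ha with rfl | ha' <;>
          rcases Finset.mem_insert.1 hb with rfl | hb'
        · exact absurd rfl hab
        · rw [hPi, hPj b (hne b hb')]
          exact hP₀d b hb'
        · rw [hPi, hPj a (hne a ha')]
          exact (hP₀d a ha').symm
        · rw [hPj a (hne a ha'), hPj b (hne b hb')]
          exact h3 a ha' b hb' hab
      · intro a ha b hb hab
        rcases Finset.mem_insert.1 ha with rfl | ha' <;>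
          rcases Finset.mem_insert.1 hb with rfl | hb'
        · exact absurd rfl hab
        · rw [hQi, hQj b (hne b hb')]
          exact hQ₀d b hb'
        · rw [hQi, hQj a (hne a ha')]
          exact (hQ₀d a ha').symm
        · rw [hQj a (hne a ha'), hQj b (hne b hb')]
          exact h4 a ha' b hb' hab
      · rw [hPU, Finset.card_insert_of_notMem hi, add_mul, one_mul]
        exact (Finset.card_union_le _ _).trans (by omega)
      · rw [hQU, Finset.card_insert_of_notMem hi, add_mul, one_mul]
        exact (Finset.card_union_le _ _).trans (by omega)
      · have hsd : (Y \ E.biUnion P) \ P₀ = Y \ (P₀ ∪ E.biUnion P) := by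
          rw [sdiff_sdiff, Finset.sup_eq_union, Finset.union_comm]
        rw [hPU, ← hsd]
        refine c4.mono_active ?_
        intro u hu
        simp only [Finset.mem_union, Finset.mem_sdiff, Finset.mem_image, Finset.mem_compl,
          Finset.mem_insert, not_or] at hu
        have hterm : ∀ v ∉ Y, v ∉ P₀ := fun v hv hvP => hv (Finset.sdiff_subset (hP₀ hvP))
        rw [Finset.mem_sdiff, Finset.mem_insert, Finset.mem_insert, hAct]
        rcases hu with ⟨⟨hu1, hu2⟩, hu3⟩ | ⟨j, ⟨hj1, hj2⟩, rfl⟩ | ⟨j, ⟨hj1, hj2⟩, rfl⟩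
        · refine ⟨Finset.mem_union_left _ (Finset.mem_sdiff.2 ⟨hu1, hu2⟩), ?_⟩
          rintro (rfl | rfl | h9)
          · exact hsY i hu1
          · exact htY i hu1
          · exact hu3 h9
        · refine ⟨Finset.mem_union_right _ (Finset.mem_union_left _
            (Finset.mem_image_of_mem s (Finset.mem_compl.2 hj2))), ?_⟩
          rintro (h9 | h9 | h9)
          · exact hj1 (hss h9)
          · exact hst _ _ h9
          · exact hterm _ (hsY j) h9
        · refine ⟨Finset.mem_union_right _ (Finset.mem_union_right _
            (Finset.mem_image_of_mem t (Finset.mem_compl.2 hj2))), ?_⟩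
          rintro (h9 | h9 | h9)
          · exact hst _ _ h9.symm
          · exact hj1 (htt h9)
          · exact hterm _ (htY j) h9
      · intro j hj
        by_cases hji : j = i
        · subst hji
          rw [hPi, hQi]
          exact c3
        · rw [hPj j hji, hQj j hji]
          exact h8 j (Finset.mem_of_mem_insert_of_ne hj hji)
  obtain ⟨P, Q, h1, h2, h3, h4, -, -, -, h8⟩ := key Finset.univ
  exact ⟨P, Q, h1, h2, fun i j => h3 i (Finset.mem_univ _) j (Finset.mem_univ _),
    fun i j => h4 i (Finset.mem_univ _) j (Finset.mem_univ _), fun i => h8 i (Finset.mem_univ _)⟩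

end Linking

/-! ### Branch vertices, their stars and the subdivision. -/

section Assembly
open scoped Classical

lemma containsSubdivision_top_of_linking {V : Type*} {G : SimpleGraph V} {q : ℕ} (φ : Fin q ↪ V)
    (I : {p : Fin q × Fin q // p.1 < p.2} → Finset V)
    (hI : ∀ p p', p ≠ p' → Disjoint (I p) (I p')) (hφ : ∀ w p, φ w ∉ I p)
    (hwalk : ∀ p : {p : Fin q × Fin q // p.1 < p.2}, ∃ r : G.Walk (φ p.1.1) (φ p.1.2),
      ∀ u ∈ r.support, u = φ p.1.1 ∨ u = φ p.1.2 ∨ u ∈ I p) :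
    ContainsSubdivision (⊤ : SimpleGraph (Fin q)) G := by
  have hpath : ∀ p : {p : Fin q × Fin q // p.1 < p.2}, ∃ r : G.Walk (φ p.1.1) (φ p.1.2),
      r.IsPath ∧ ∀ u ∈ r.support, u = φ p.1.1 ∨ u = φ p.1.2 ∨ u ∈ I p := by
    intro p
    obtain ⟨r, hr⟩ := hwalk p
    exact ⟨r.bypass, r.bypass_isPath, fun u hu => hr u (r.support_bypass_subset_support hu)⟩
  choose r hr hrs using hpath
  -- Only pairs a < b carry a chosen path; the other orientation is its reversal, so the symmetry
  -- condition holds by construction.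
  let P : ∀ a b : Fin q, (⊤ : SimpleGraph (Fin q)).Adj a b → G.Walk (φ a) (φ b) := fun a b h =>
    if hab : a < b then r ⟨(a, b), hab⟩ else
      (r ⟨(b, a), lt_of_le_of_ne (not_lt.1 hab) (Ne.symm h.ne)⟩).reverse
  have hP : ∀ (a b : Fin q) (h : (⊤ : SimpleGraph (Fin q)).Adj a b),
      ∃ p : {p : Fin q × Fin q // p.1 < p.2}, s(p.1.1, p.1.2) = s(a, b) ∧
        ∀ u ∈ (P a b h).support, u = φ a ∨ u = φ b ∨ u ∈ I p := by
    intro a b h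
    by_cases hab : a < b
    · refine ⟨⟨(a, b), hab⟩, rfl, fun u hu => ?_⟩
      simp only [P, dif_pos hab] at hu
      exact hrs _ u hu
    · refine ⟨⟨(b, a), lt_of_le_of_ne (not_lt.1 hab) (Ne.symm h.ne)⟩, Sym2.eq_swap,
        fun u hu => ?_⟩
      simp only [P, dif_neg hab, SimpleGraph.Walk.support_reverse, List.mem_reverse] at hu
      have := hrs _ u hu
      tauto
  refine ⟨φ, P, ?_, ?_, ?_, ?_⟩
  · intro a b h
    by_cases hab : a < b
    · simp only [P, dif_pos hab]
      exact hr _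
    · simp only [P, dif_neg hab]
      exact (hr _).reverse
  · intro a b h
    rcases lt_or_gt_of_ne h.ne with hab | hab
    · simp only [P, dif_pos hab, dif_neg hab.not_gt]
    · simp only [P, dif_pos hab, dif_neg hab.not_gt, SimpleGraph.Walk.reverse_reverse]
  · intro a b h w hw
    obtain ⟨p, -, hp⟩ := hP a b h
    rcases hp _ hw with h1 | h1 | h1
    · exact Or.inl (φ.injective h1)
    · exact Or.inr (φ.injective h1)
    · exact absurd h1 (hφ w p)
  · intro a b a' b' h h' hne v hv hv'
    obtain ⟨p, hp, hps⟩ := hP a b h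
    obtain ⟨p', hp', hps'⟩ := hP a' b' h'
    rcases hps v hv with h1 | h1 | h1
    · exact ⟨a, h1.symm⟩
    · exact ⟨b, h1.symm⟩
    rcases hps' v hv' with h2 | h2 | h2
    · exact ⟨a', h2.symm⟩
    · exact ⟨b', h2.symm⟩
    have hpp : p ≠ p' := by
      rintro rfl
      exact hne (hp.symm.trans hp')
    exact absurd h2 (Finset.disjoint_left.1 (hI p p' hpp) h1)

lemma exists_embedding_into {V : Type*} {q : ℕ} {S : Finset V} (h : q ≤ S.card) :
    ∃ f : Fin q ↪ V, ∀ i, f i ∈ S := by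
  obtain ⟨S', hS', hc⟩ := Finset.exists_subset_card_eq h
  let e := (Finset.equivFinOfCardEq hc).symm
  exact ⟨e.toEmbedding.trans (Function.Embedding.subtype _), fun i => hS' (e i).2⟩

variable {V : Type*} [Fintype V] {G : SimpleGraph V}

/-- Greedy choice: outside the closure of the vertices used so far, every vertex still has d(G)/16
neighbours outside it. The closure has at most twice as many vertices, which is less than Γ has. -/
lemma exists_disjoint_stars {β : ℝ} (hβ : β < 1 / 16) (hD : 0 < avgDegree G) {Γ : Finset V}
    (hΓ : ∀ v ∈ Γ, avgDegree G / 8 ≤ ((nbr G v ∩ Γ).card : ℝ))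
    (hΓc : cruxNumber β G ≤ Γ.card) {L : ℕ} (hL : (L : ℝ) ≤ avgDegree G / 16) (j : ℕ)
    (hj : 2 * (j * (L + 1)) < cruxNumber β G) :
    ∃ Φ ⊆ Γ, ∃ lf : V → Finset V, Φ.card = j ∧ ∀ v ∈ Φ, lf v ⊆ nbr G v ∩ Γ ∧ (lf v).card = L ∧
      Disjoint (lf v) Φ ∧ ∀ u ∈ Φ, u ≠ v → Disjoint (lf v) (lf u) := by
  induction j with
  | zero => exact ⟨∅, by simp, fun _ => ∅, by simp, by simp⟩
  | succ j ih =>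
    have hjs : (j + 1) * (L + 1) = j * (L + 1) + (L + 1) := by ring
    obtain ⟨Φ, hΦ, lf, hc, hlf⟩ := ih (by omega)
    have hUc : (Φ ∪ Φ.biUnion lf).card ≤ j * (L + 1) := by
      refine (Finset.card_union_le _ _).trans ?_
      have h1 : (Φ.biUnion lf).card ≤ Φ.card * L :=
        Finset.card_biUnion_le_card_mul _ _ _ fun v hv => (hlf v hv).2.1.le
      rw [hc] at h1 ⊢
      rw [mul_add]
      omega
    have hUΓ : Φ ∪ Φ.biUnion lf ⊆ Γ := Finset.union_subset hΦ
      (Finset.biUnion_subset.2 fun v hv => (hlf v hv).1.trans Finset.inter_subset_right)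
    obtain ⟨B, hUB, hBΓ, hBc, hB⟩ := exists_closure (β := β) hβ hD hΓ hUΓ (by omega)
    obtain ⟨v, hvΓ, hvB⟩ := Finset.exists_mem_notMem_of_card_lt_card
      (show B.card < Γ.card by omega)
    have hv := hL.trans (hB v (Finset.mem_sdiff.2 ⟨hvΓ, hvB⟩))
    obtain ⟨L₀, hL₀, hL₀c⟩ := Finset.exists_subset_card_eq
      (show L ≤ (nbr G v ∩ (Γ \ B)).card by exact_mod_cast hv)
    have hvΦ : v ∉ Φ := fun h => hvB (hUB (Finset.mem_union_left _ h))
    have hL₀B : Disjoint L₀ B := by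
      rw [Finset.disjoint_left]
      intro u hu
      exact (Finset.mem_sdiff.1 (Finset.mem_inter.1 (hL₀ hu)).2).2
    have hvL₀ : v ∉ L₀ := fun h =>
      G.loopless.irrefl v (mem_nbr.1 (Finset.mem_inter.1 (hL₀ h)).1)
    have hfB : ∀ u ∈ Φ, lf u ⊆ B := fun u hu =>
      (Finset.subset_biUnion_of_mem lf hu).trans (Finset.subset_union_right.trans hUB)
    have hfv : Function.update lf v L₀ v = L₀ := Function.update_self _ _ _
    have hfu : ∀ u ∈ Φ, Function.update lf v L₀ u = lf u := fun u hu =>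
      Function.update_of_ne (by rintro rfl; exact hvΦ hu) _ _
    refine ⟨insert v Φ, Finset.insert_subset hvΓ hΦ, Function.update lf v L₀, ?_, ?_⟩
    · rw [Finset.card_insert_of_notMem hvΦ, hc]
    · intro u hu
      rcases Finset.mem_insert.1 hu with rfl | hu'
      · rw [hfv]
        refine ⟨hL₀.trans (Finset.inter_subset_inter_left Finset.sdiff_subset), hL₀c, ?_, ?_⟩
        · rw [Finset.disjoint_insert_right]
          exact ⟨hvL₀, hL₀B.mono_right (Finset.subset_union_left.trans hUB)⟩
        · intro z hz hzu
          have hz' := Finset.mem_of_mem_insert_of_ne hz hzu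
          rw [hfu z hz']
          exact hL₀B.mono_right (hfB z hz')
      · rw [hfu u hu']
        obtain ⟨h1, h2, h3, h4⟩ := hlf u hu'
        refine ⟨h1, h2, ?_, ?_⟩
        · rw [Finset.disjoint_insert_right]
          exact ⟨fun h => hvB (hfB u hu' h), h3⟩
        · intro z hz hzu
          rcases Finset.mem_insert.1 hz with rfl | hz'
          · rw [hfv]
            exact (hL₀B.mono_right (hfB u hu')).symm
          · rw [hfu z hz']
            exact h4 z hz' hzu

/-- There are `q` disjoint stars with `q` leaves, all of whose leaves have many neighbours in a set
`Y` avoiding the stars with large induced minimum degree. -/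
lemma exists_stars_with_expanding_leaves {β : ℝ} (hβ0 : 0 < β) (hβ : β ≤ 1 / 150)
    (hD : 0 < avgDegree G) {Γ : Finset V}
    (hΓ : ∀ v ∈ Γ, avgDegree G / 8 ≤ ((nbr G v ∩ Γ).card : ℝ))
    (hΓc : cruxNumber β G ≤ Γ.card) {q : ℕ} (hq : 1 ≤ q)
    (hqD : ((4 * q : ℕ) : ℝ) ≤ avgDegree G / 16)
    (hqC : 2 * (2 * q * (4 * q + 1)) < cruxNumber β G) :
    ∃ (Y : Finset V) (φ : Fin q ↪ V) (ψ : Fin q → Fin q → V), Y ⊆ Γ ∧ (∀ i, φ i ∈ Γ \ Y) ∧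
      (∀ i j, ψ i j ∈ Γ \ Y) ∧ (∀ i j, G.Adj (φ i) (ψ i j)) ∧
      (∀ i j i' j', ψ i j = ψ i' j' → i = i' ∧ j = j') ∧ (∀ i i' j, φ i ≠ ψ i' j) ∧
      (∀ x ∈ Y, avgDegree G / 16 ≤ ((nbr G x ∩ Y).card : ℝ)) ∧
      ∀ i j, avgDegree G / 16 ≤ ((nbr G (ψ i j) ∩ Y).card : ℝ) := by
  have hβ16 : β < 1 / 16 := by linarith
  -- Twice as many stars with four times as many leaves as needed, since some leaves will send too
  -- few edges to Y.
  obtain ⟨Φ, hΦ, lf, hc, hlf⟩ := exists_disjoint_stars hβ16 hD hΓ hΓc hqD (2 * q) hqC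
  have hlc : (Φ.biUnion lf).card ≤ 2 * q * (4 * q) := by
    rw [← hc]
    exact Finset.card_biUnion_le_card_mul _ _ _ fun v hv => (hlf v hv).2.1.le
  set U := Φ ∪ Φ.biUnion lf with hU
  have hUc : U.card ≤ 2 * q * (4 * q + 1) := by
    refine (Finset.card_union_le _ _).trans ?_
    rw [hc, mul_add]
    omega
  have hUΓ : U ⊆ Γ := Finset.union_subset hΦ
    (Finset.biUnion_subset.2 fun v hv => (hlf v hv).1.trans Finset.inter_subset_right)
  obtain ⟨B, hUB, hBΓ, hBc, hB⟩ := exists_closure (β := β) hβ16 hD hΓ hUΓ (by omega)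
  set bad := (Φ.biUnion lf).filter
    (fun w => ((nbr G w ∩ (Γ \ B)).card : ℝ) < avgDegree G / 16) with hbad
  have hbadB : bad ⊆ B := (Finset.filter_subset _ _).trans (Finset.subset_union_right.trans hUB)
  have hBne : B.Nonempty := by
    have : Φ.Nonempty := Finset.card_pos.1 (by omega)
    exact this.mono (Finset.subset_union_left.trans hUB)
  -- A bad leaf sends at least d(G)/16 edges into B, and B is sparse because it is smaller than the
  -- crux.
  have hbadc : 75 * bad.card ≤ 16 * (2 * q * (4 * q + 1)) := by
    have h1 := degSum_lt_of_card_lt_cruxNumber (G := G) (β := β) hBne (by omega)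
    have h2 : (bad.card : ℝ) * (avgDegree G / 16) ≤
        ((∑ w ∈ bad, (nbr G w ∩ B).card : ℕ) : ℝ) := by
      rw [Nat.cast_sum, ← nsmul_eq_mul]
      refine Finset.card_nsmul_le_sum _ _ _ fun w hw => ?_
      have h3 := (Finset.mem_filter.1 hw).2
      have h4 := hΓ w (hBΓ (hbadB hw))
      have h5 : (nbr G w ∩ Γ).card ≤ (nbr G w ∩ (Γ \ B)).card + (nbr G w ∩ B).card := by
        refine (Finset.card_le_card ?_).trans (Finset.card_union_le _ _)
        intro u hu
        by_cases huB : u ∈ B <;> simp_all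
      have h5' : ((nbr G w ∩ Γ).card : ℝ) ≤ (nbr G w ∩ (Γ \ B)).card + (nbr G w ∩ B).card := by
        exact_mod_cast h5
      linarith
    have h3 : ((∑ w ∈ bad, (nbr G w ∩ B).card : ℕ) : ℝ) ≤ degSum G B := by
      exact_mod_cast degSum_le_of_subset hbadB subset_rfl
    have h4 : β * (avgDegree G * B.card) ≤ 1 / 150 * (avgDegree G * B.card) :=
      mul_le_mul_of_nonneg_right hβ (by positivity)
    have h5 : avgDegree G * (bad.card / 16) < avgDegree G * (B.card / 150) := by linarith
    have h6 := lt_of_mul_lt_mul_left h5 hD.le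
    have h7 : (75 * bad.card : ℝ) ≤ 8 * B.card := by linarith
    have h8 : 75 * bad.card ≤ 8 * B.card := by exact_mod_cast h7
    omega
  set good := Φ.filter (fun v => q ≤ (lf v \ bad).card) with hgood
  -- Otherwise at least q stars have 3q bad leaves each. Then 225 q² ≤ 75 |bad| ≤ 32 q (4q + 1) ≤
  -- 160 q², a contradiction.
  have hgoodc : q ≤ good.card := by
    by_contra hlt
    push Not at hlt
    have h1 : q ≤ (Φ \ good).card := by
      have := Finset.card_sdiff_add_card_eq_card (show good ⊆ Φ from Finset.filter_subset _ _)
      omega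
    have h2 : (Φ \ good).card * (3 * q) ≤ ((Φ \ good).biUnion (fun v => lf v ∩ bad)).card := by
      rw [Finset.card_biUnion, ← smul_eq_mul]
      · refine Finset.card_nsmul_le_sum _ _ _ fun v hv => ?_
        obtain ⟨hv1, hv2⟩ := Finset.mem_sdiff.1 hv
        have h3 : ¬ q ≤ (lf v \ bad).card := fun h => hv2 (Finset.mem_filter.2 ⟨hv1, h⟩)
        have h4 := Finset.card_sdiff_add_card_inter (lf v) bad
        have h5 := (hlf v hv1).2.1
        omega
      · intro v hv u hu hvu
        exact ((hlf v (Finset.mem_sdiff.1 hv).1).2.2.2 u (Finset.mem_sdiff.1 hu).1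
          hvu.symm).mono Finset.inter_subset_left Finset.inter_subset_left
    have h3 : ((Φ \ good).biUnion (fun v => lf v ∩ bad)).card ≤ bad.card :=
      Finset.card_le_card (Finset.biUnion_subset.2 fun v _ => Finset.inter_subset_right)
    have h4 := (Nat.mul_le_mul_right (3 * q) h1).trans (h2.trans h3)
    nlinarith
  obtain ⟨φ, hφ⟩ := exists_embedding_into hgoodc
  have hφΦ : ∀ i, φ i ∈ Φ := fun i => Finset.filter_subset _ _ (hφ i)
  have hψ : ∀ i, ∃ f : Fin q ↪ V, ∀ j, f j ∈ lf (φ i) \ bad := fun i =>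
    exists_embedding_into (Finset.mem_filter.1 (hφ i)).2
  choose ψ hψ using hψ
  have hψl : ∀ i j, ψ i j ∈ lf (φ i) := fun i j => (Finset.mem_sdiff.1 (hψ i j)).1
  have hψU : ∀ i j, ψ i j ∈ Φ.biUnion lf := fun i j =>
    Finset.mem_biUnion.2 ⟨φ i, hφΦ i, hψl i j⟩
  have hB' : ∀ v ∈ U, v ∈ Γ \ (Γ \ B) := fun v hv =>
    Finset.mem_sdiff.2 ⟨hUΓ hv, fun h => (Finset.mem_sdiff.1 h).2 (hUB hv)⟩
  refine ⟨Γ \ B, φ, fun i j => ψ i j, Finset.sdiff_subset,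
    fun i => hB' _ (Finset.mem_union_left _ (hφΦ i)),
    fun i j => hB' _ (Finset.mem_union_right _ (hψU i j)), ?_, ?_, ?_, hB, ?_⟩
  · intro i j
    exact mem_nbr.1 (Finset.mem_inter.1 ((hlf _ (hφΦ i)).1 (hψl i j))).1
  · intro i j i' j' h
    have h : ψ i j = ψ i' j' := h
    have hii : i = i' := by
      by_contra hne
      have hd := (hlf _ (hφΦ i)).2.2.2 _ (hφΦ i') fun h' => hne (φ.injective h').symm
      exact Finset.disjoint_left.1 hd (hψl i j) (by rw [h]; exact hψl i' j')
    subst hii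
    exact ⟨rfl, (ψ i).injective h⟩
  · intro i i' j h
    have h : φ i = ψ i' j := h
    exact Finset.disjoint_left.1 (hlf _ (hφΦ i')).2.2.1 (hψl i' j) (by rw [← h]; exact hφΦ i)
  · intro i j
    by_contra hlt
    exact (Finset.mem_sdiff.1 (hψ i j)).2 (Finset.mem_filter.2 ⟨hψU i j, not_le.1 hlt⟩)

/-- The pair a < b is linked between the leaf of a reserved for b and the leaf of b reserved for a.
Branches lie in Y, connections in R, and stars in Γ \ Y, so parts of different kinds never meet. The
bound 18h ≤ C provides eightfold expansion up to size 2h. -/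
lemma containsSubdivision_top_of_connectsLargeSets {β : ℝ} (hβ0 : 0 < β) (hβ : β ≤ 1 / 150)
    (hD : 0 < avgDegree G) {Γ R : Finset V} (hΓR : Disjoint Γ R) (hΓne : Γ.Nonempty)
    (hΓ : ∀ v ∈ Γ, avgDegree G / 8 ≤ ((nbr G v ∩ Γ).card : ℝ)) {q h J ℓ w : ℕ} (hq : 1 ≤ q)
    (hqD : ((4 * q : ℕ) : ℝ) ≤ avgDegree G / 16)
    (hqC : 2 * (2 * q * (4 * q + 1)) < cruxNumber β G) (hh : 1 ≤ h) (hJ : 2 ^ J ≤ h)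
    (hhC : 18 * h ≤ cruxNumber β G) (hqJ : q * q * (2 * J) ≤ h) (hqw : q * q * (ℓ + 1) ≤ w)
    (hC : ConnectsLargeSets G R (2 ^ J) ℓ w) :
    ContainsSubdivision (⊤ : SimpleGraph (Fin q)) G := by
  have hΓc : cruxNumber β G ≤ Γ.card :=
    cruxNumber_le_of_minDegree hΓne fun v hv => le_trans (by nlinarith) (hΓ v hv)
  obtain ⟨Y, φ, ψ, hYΓ, hφ, hψ, hadj, hinj, hφψ, hYd, hψd⟩ :=
    exists_stars_with_expanding_leaves hβ0 hβ hD hΓ hΓc hq hqD hqC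
  have hcard : Fintype.card {p : Fin q × Fin q // p.1 < p.2} ≤ q * q := by
    refine (Fintype.card_subtype_le _).trans ?_
    simp
  obtain ⟨P, Q, h1, h2, h3, h4, h5⟩ := exists_disjoint_linking
    (ι := {p : Fin q × Fin q // p.1 < p.2}) (G := G) (Y := Y) hh hJ
    (fun p => ψ p.1.1 p.1.2) (fun p => ψ p.1.2 p.1.1)
    (fun p => (Finset.mem_sdiff.1 (hψ _ _)).2) (fun p => (Finset.mem_sdiff.1 (hψ _ _)).2)
    (fun p p' hpp => Subtype.ext (Prod.ext (hinj _ _ _ _ hpp).1 (hinj _ _ _ _ hpp).2))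
    (fun p p' hpp => Subtype.ext (Prod.ext (hinj _ _ _ _ hpp).2 (hinj _ _ _ _ hpp).1))
    (fun p p' hpp => by
      obtain ⟨h6, h7⟩ := hinj _ _ _ _ hpp
      have h8 := p.2
      rw [h6, h7] at h8
      exact absurd p'.2 h8.not_gt)
    (fun X hX hXh => card_nbrs_ge hβ hD (fun v hv => by
      rcases Finset.mem_union.1 (hX hv) with h6 | h6
      · exact hYd v h6
      · rcases Finset.mem_union.1 h6 with h6 | h6
        · obtain ⟨p, -, rfl⟩ := Finset.mem_image.1 h6
          exact hψd _ _
        · obtain ⟨p, -, rfl⟩ := Finset.mem_image.1 h6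
          exact hψd _ _) (by omega))
    hC ((Nat.mul_le_mul_right _ hcard).trans hqJ) ((Nat.mul_le_mul_right _ hcard).trans hqw)
  have hΓY : ∀ v ∈ Γ \ Y, v ∉ Y ∧ v ∉ R := fun v hv =>
    ⟨(Finset.mem_sdiff.1 hv).2, Finset.disjoint_left.1 hΓR (Finset.mem_sdiff.1 hv).1⟩
  have hYR : Disjoint Y R := hΓR.mono_left hYΓ
  refine containsSubdivision_top_of_linking φ
    (fun p => {ψ p.1.1 p.1.2, ψ p.1.2 p.1.1} ∪ (P p ∪ Q p)) ?_ ?_ ?_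
  · intro p p' hpp
    have hψ1 : ∀ (i j : Fin q) (p : {p : Fin q × Fin q // p.1 < p.2}), ψ i j ∉ P p ∪ Q p := by
      intro i j p hp
      rcases Finset.mem_union.1 hp with hp | hp
      · exact (hΓY _ (hψ i j)).1 (h1 p hp)
      · exact (hΓY _ (hψ i j)).2 (h2 p hp)
    have hterm : Disjoint ({ψ p.1.1 p.1.2, ψ p.1.2 p.1.1} : Finset V)
        {ψ p'.1.1 p'.1.2, ψ p'.1.2 p'.1.1} := by
      rw [Finset.disjoint_left]
      intro u hu hu'
      simp only [Finset.mem_insert, Finset.mem_singleton] at hu hu'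
      have h8 := p.2
      have h9 := p'.2
      rcases hu with rfl | rfl <;> rcases hu' with hu' | hu' <;>
        obtain ⟨h6, h7⟩ := hinj _ _ _ _ hu'
      · exact hpp (Subtype.ext (Prod.ext h6 h7))
      · rw [h6, h7] at h8
        exact absurd h9 h8.not_gt
      · rw [h6, h7] at h8
        exact absurd h9 h8.not_gt
      · exact hpp (Subtype.ext (Prod.ext h7 h6))
    have hleft : ∀ p p' : {p : Fin q × Fin q // p.1 < p.2},
        Disjoint ({ψ p.1.1 p.1.2, ψ p.1.2 p.1.1} : Finset V) (P p' ∪ Q p') := by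
      intro p p'
      rw [Finset.disjoint_left]
      intro u hu
      simp only [Finset.mem_insert, Finset.mem_singleton] at hu
      rcases hu with rfl | rfl <;> exact hψ1 _ _ _
    refine Finset.disjoint_union_left.2 ⟨Finset.disjoint_union_right.2 ⟨hterm, hleft p p'⟩,
      Finset.disjoint_union_right.2 ⟨(hleft p' p).symm, Finset.disjoint_union_left.2
        ⟨Finset.disjoint_union_right.2 ⟨h3 p p' hpp, hYR.mono (h1 p) (h2 p')⟩,
          Finset.disjoint_union_right.2 ⟨(hYR.mono (h1 p') (h2 p)).symm, h4 p p' hpp⟩⟩⟩⟩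
  · intro i p hp
    simp only [Finset.mem_union, Finset.mem_insert, Finset.mem_singleton] at hp
    rcases hp with (hp | hp) | hp | hp
    · exact hφψ _ _ _ hp
    · exact hφψ _ _ _ hp
    · exact (hΓY _ (hφ i)).1 (h1 p hp)
    · exact (hΓY _ (hφ i)).2 (h2 p hp)
  · intro p
    obtain ⟨r, hr⟩ := h5 p
    refine ⟨SimpleGraph.Walk.cons (hadj p.1.1 p.1.2) (r.concat (hadj p.1.2 p.1.1).symm), ?_⟩
    intro u hu
    rw [SimpleGraph.Walk.support_cons, List.mem_cons, SimpleGraph.Walk.support_concat,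
      List.mem_append, List.mem_singleton] at hu
    simp only [Finset.mem_union, Finset.mem_insert, Finset.mem_singleton]
    rcases hu with hu | hu | hu
    · exact Or.inl hu
    · have := hr u hu
      tauto
    · exact Or.inr (Or.inl hu)

end Assembly

/-! ### From the expander hypotheses to the parameters. -/

section Parameters
open scoped Classical
variable {V : Type*} [Fintype V] {G : SimpleGraph V}

/-- The rate decreases in |X| on the range considered, so its value at |X| = n can be used for all
sizes: it allows fewer deletions and asks for fewer neighbours. -/
lemma expandsAtRate_of_isRobustExpander {ε : ℝ} (hε : 0 < ε) {k : ℕ} (hk : 1 ≤ k)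
    (h : IsRobustExpander ε k G) :
    ExpandsAtRate G k (ε / Real.log (15 * (Fintype.card V : ℝ) / k) ^ 2) := by
  intro X hX hXn F hF hFc
  have hk0 : (0 : ℝ) < k := by exact_mod_cast hk
  have hXle : (X.card : ℝ) ≤ Fintype.card V := by exact_mod_cast Finset.card_le_univ X
  have h1 : (1 : ℝ) < 15 * X.card / k := by
    rw [lt_div_iff₀ hk0]
    linarith
  have h2 : 0 < Real.log (15 * (X.card : ℝ) / k) := Real.log_pos h1
  have h3 : Real.log (15 * (X.card : ℝ) / k) ≤ Real.log (15 * (Fintype.card V : ℝ) / k) := by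
    refine Real.log_le_log (by linarith) ?_
    gcongr
  have h4 : expansionRate ε k X.card = ε / Real.log (15 * (X.card : ℝ) / k) ^ 2 := by
    rw [expansionRate, if_neg (by linarith)]
  have h5 : ε / Real.log (15 * (Fintype.card V : ℝ) / k) ^ 2 ≤ expansionRate ε k X.card := by
    rw [h4]
    gcongr
  have hD : 0 ≤ avgDegree G := by rw [avgDegree]; positivity
  have h6 := h X hX hXn F hF (hFc.trans (by gcongr))
  exact le_trans (by gcongr) h6

lemma exp_half_le_one_add {y : ℝ} (hy : 0 ≤ y) (hy' : y ≤ 1) : Real.exp (y / 2) ≤ 1 + y := by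
  have h1 := Real.add_one_le_exp (-(y / 2))
  rw [Real.exp_neg] at h1
  have h2 : 0 < -(y / 2) + 1 := by linarith
  have h3 : Real.exp (y / 2) ≤ (-(y / 2) + 1)⁻¹ := by
    rw [le_inv_comm₀ (Real.exp_pos _) h2]
    exact h1
  refine h3.trans ?_
  rw [inv_le_iff_one_le_mul₀ h2]
  nlinarith

lemma log_fifteen_lt : Real.log 15 < 3 := by
  rw [Real.log_lt_iff_lt_exp (by norm_num)]
  have h1 : Real.exp 3 = Real.exp 1 ^ 3 := by
    rw [← Real.exp_nat_mul]
    norm_num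
  have h2 : (2.7182818283 : ℝ) ^ 3 < Real.exp 1 ^ 3 :=
    pow_lt_pow_left₀ Real.exp_one_gt_d9 (by norm_num) (by norm_num)
  rw [h1]
  norm_num at h2 ⊢
  linarith

lemma containsSubdivision_top_of_le_one {V : Type*} [Nonempty V] {G : SimpleGraph V} {q : ℕ}
    (hq : q ≤ 1) : ContainsSubdivision (⊤ : SimpleGraph (Fin q)) G := by
  have hsub : Subsingleton (Fin q) := Fin.subsingleton_iff_le_one.2 hq
  obtain ⟨v⟩ := ‹Nonempty V›
  refine containsSubdivision_top_of_linking
    ⟨fun _ => v, fun a b _ => Subsingleton.elim a b⟩ (fun _ => ∅) (by simp) (by simp) fun p => ?_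
  exact absurd p.2 (by rw [Subsingleton.elim p.1.1 p.1.2]; exact lt_irrefl _)

/-- A robust expander of polylogarithmic average degree contains a clique subdivision of an order
for which the branching parts of the paths fit into the crux and the connecting parts do not
obstruct the expansion. -/
lemma containsSubdivision_top_of_expandsAtRate [Nonempty V] {β k r : ℝ} (hβ0 : 0 < β)
    (hβ : β ≤ 1 / 150) (hD : 0 < avgDegree G) (hk : 0 < k) (hr : 0 < r) (hr' : r ≤ 1)
    (hexp : ExpandsAtRate G k r) (hlog : 1 ≤ Real.log (Fintype.card V))
    (hDr : 960 * Real.log (Fintype.card V) ≤ r * (avgDegree G * r))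
    (hDlog : 8 * Real.log (Fintype.card V) + 40 ≤ avgDegree G / 2) {q i J h w : ℕ} (hq : 1 ≤ q)
    (hqD : ((4 * q : ℕ) : ℝ) ≤ avgDegree G / 16)
    (hqC : 2 * (2 * q * (4 * q + 1)) < cruxNumber β G) (hh : 1 ≤ h) (hJ : 2 ^ J ≤ h)
    (hhC : 18 * h ≤ cruxNumber β G) (hqJ : q * q * (2 * J) ≤ h)
    (hqw : q * q * (2 * i + 2 + 1) ≤ w)
    (hkM : k ≤ r * (2 ^ J : ℕ) / 4) (hw : (w : ℝ) < r * (r * (2 ^ J : ℕ) / 4) / 16)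
    (hi : (Fintype.card V : ℝ) ≤ (1 + r / 4) ^ i * k) :
    ContainsSubdivision (⊤ : SimpleGraph (Fin q)) G := by
  obtain ⟨S, hSne, hS⟩ := exists_minDegree_subset hD
  obtain ⟨R, hR1, hR2, hR3⟩ := exists_splitting_set hlog rfl hDlog
    (expandingPart G (avgDegree G * r)) (fun X X' => closedNbrs G X ∩ closedNbrs G X') S
    (fun v => nbr G v ∩ S) hS
  have hCn : cruxNumber β G ≤ Fintype.card V :=
    (cruxNumber_le_of_minDegree hSne fun v hv => le_trans (by nlinarith) (hS v hv)).trans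
      (Finset.card_le_univ S)
  have hΓ : ∀ v ∈ S, avgDegree G / 8 ≤ ((nbr G v ∩ (S \ R)).card : ℝ) := by
    intro v hv
    have h1 := hR1 v hv
    have h2 := hS v hv
    rw [Finset.inter_sdiff_assoc] at h1
    linarith
  obtain ⟨v, hv⟩ := hSne
  have hΓne : (S \ R).Nonempty := by
    have h1 : (0 : ℝ) < (nbr G v ∩ (S \ R)).card := lt_of_lt_of_le (by linarith) (hΓ v hv)
    have h2 : (nbr G v ∩ (S \ R)).Nonempty := Finset.card_pos.1 (by exact_mod_cast h1)
    exact h2.mono Finset.inter_subset_right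
  have hM : ((2 ^ J : ℕ) : ℝ) ≤ 2 * (Fintype.card V : ℝ) / 3 := by
    have h1 : 18 * 2 ^ J ≤ Fintype.card V := by omega
    have h2 : (18 : ℝ) * (2 ^ J : ℕ) ≤ Fintype.card V := by exact_mod_cast h1
    have h3 : (0 : ℝ) ≤ (Fintype.card V : ℝ) := Nat.cast_nonneg _
    linarith
  -- Here g = d(G) r and κ = 40 log n, so 24κ ≤ r g is the hypothesis `hDr` with 960 = 24 · 40.
  have hC : ConnectsLargeSets G R (2 ^ J) (2 * i + 2) w :=
    connectsLargeSets_of_expandsAtRate hexp hk hr hr' (by positivity) le_rfl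
      (by linarith) (by linarith) hR2 hR3 hkM hw hM hi
  exact containsSubdivision_top_of_connectsLargeSets hβ0 hβ hD Finset.sdiff_disjoint hΓne
    (fun v hv => hΓ v (Finset.sdiff_subset hv)) hq hqD hqC hh hJ hhC hqJ hqw hC

end Parameters

/-! ### Choice of the constants and the main statement. -/

set_option maxHeartbeats 1000000 in
theorem lemma3p5 (β ε : ℝ) (hβ : 0 < β) (hβ' : β ≤ 1 / 150) (hε : 0 < ε) (hε' : ε ≤ 1 / 150) :
    ∃ T₀ c₀ : ℝ, 0 < T₀ ∧ 0 < c₀ ∧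
      ∀ T c : ℝ, T₀ ≤ T → 0 < c → c ≤ c₀ →
        ∃ (n₀ : ℕ) (d₀ : ℝ),
          ∀ (V : Type*) [Fintype V] (G : SimpleGraph V) [DecidableRel G.Adj]
            (n x k : ℕ) (d t m : ℝ),
            Fintype.card V = n → n₀ ≤ n → d₀ ≤ d →
            13 < x → 1 ≤ k → (k : ℝ) ≤ (n : ℝ) / T →
            (Real.log (n : ℝ)) ^ (25 * x) ≤ d →
            IsRobustExpander ε k G →
            d ≤ avgDegree G → d / 2 ≤ (G.minDegree : ℝ) →
            m = (Real.log ((n : ℝ) / (k : ℝ))) ^ 4 →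
            t = min d
              (Real.sqrt ((cruxNumber β G : ℝ) / Real.log (cruxNumber β G : ℝ))) →
            (k : ℝ) ≤ t ^ 2 * m →
            t ^ 2 * m ^ (4 * x) ≤ (cruxNumber β G : ℝ) / 3 →
            ContainsSubdivision (⊤ : SimpleGraph (Fin ⌈c * t⌉₊)) G := by
  -- This choice gives L = log(n/k) ≥ 1000 + 1/ε, which absorbs every numerical constant and gives ε
  -- ≥ 1/L.
  refine ⟨Real.exp (1000 + 1 / ε), 1 / 1000, Real.exp_pos _, by norm_num, ?_⟩
  intro T c hT hc hc'
  -- No further thresholds are needed: n ≥ T k is already large, and d is at least a power of log n.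
  refine ⟨0, 0, ?_⟩
  intro V _ G _ n x k d t m hn _ _ hx hk hkn hd hG hdD _ hm ht hkt htC
  have hT0 : 0 < T := (Real.exp_pos _).trans_le hT
  have hk0 : (0 : ℝ) < k := by exact_mod_cast hk
  have hk1 : (1 : ℝ) ≤ k := by exact_mod_cast hk
  have hTn : T * k ≤ n := by rw [le_div_iff₀ hT0] at hkn; linarith
  have hn0 : (0 : ℝ) < n := lt_of_lt_of_le (by positivity) hTn
  have hne : Nonempty V := by
    rw [← Fintype.card_pos_iff, hn]
    exact_mod_cast hn0
  -- Once q ≥ 2, c t > 1 and c ≤ 1/1000 force t > 1000, and rounding up costs only a factor 2.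
  by_cases hq1 : ⌈c * t⌉₊ ≤ 1
  · exact containsSubdivision_top_of_le_one hq1
  push Not at hq1
  set q := ⌈c * t⌉₊ with hq
  have hct : 1 < c * t := by
    have := Nat.lt_ceil.1 hq1
    exact_mod_cast this
  have ht0 : 0 < t := by
    by_contra h
    nlinarith
  have hqt : (q : ℝ) ≤ t / 500 := by
    have h1 : (q : ℝ) < c * t + 1 := Nat.ceil_lt_add_one (by positivity)
    have h2 : c * t ≤ 1 / 1000 * t := mul_le_mul_of_nonneg_right hc' ht0.le
    linarith
  have ht1000 : 1000 < t := by nlinarith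
  -- the logarithmic scale
  set L := Real.log ((n : ℝ) / k) with hL
  have hLT : 1000 + 1 / ε ≤ L := by
    rw [hL, Real.le_log_iff_exp_le (by positivity), le_div_iff₀ hk0]
    exact (mul_le_mul_of_nonneg_right hT hk0.le).trans hTn
  have hεinv : 0 < 1 / ε := by positivity
  have hL1000 : 1000 ≤ L := by linarith
  have hLε : 1 / L ≤ ε := by
    rw [div_le_comm₀ (by linarith) hε]
    linarith
  set l := Real.log (n : ℝ) with hl
  have hLl : L ≤ l := Real.log_le_log (by positivity) (div_le_self hn0.le hk1)
  have hl1000 : 1000 ≤ l := hL1000.trans hLl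
  have hL0 : 0 < L := by linarith
  have hl0 : 0 < l := by linarith
  have hDl : l ^ 10 ≤ avgDegree G :=
    (pow_le_pow_right₀ (by linarith) (by omega)).trans (hd.trans hdD)
  have hl9 : (1000 : ℝ) ^ 9 ≤ l ^ 9 := pow_le_pow_left₀ (by norm_num) hl1000 9
  have hDl' : 1000 ^ 9 * l ≤ avgDegree G := by
    refine le_trans ?_ hDl
    rw [pow_succ l 9]
    exact mul_le_mul_of_nonneg_right hl9 hl0.le
  have hD0 : 0 < avgDegree G := lt_of_lt_of_le (by positivity) hDl'
  -- the expansion rate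
  set r := ε / Real.log (15 * (Fintype.card V : ℝ) / k) ^ 2 with hr
  have hlog15 : Real.log (15 * (Fintype.card V : ℝ) / k) = Real.log 15 + L := by
    rw [hn, mul_div_assoc, Real.log_mul (by norm_num) (by positivity)]
  have hlog15pos : 0 < Real.log 15 := Real.log_pos (by norm_num)
  have hexp : ExpandsAtRate G k r := expandsAtRate_of_isRobustExpander hε hk hG
  have hden : 0 < Real.log 15 + L := by linarith
  have hr0 : 0 < r := by rw [hr, hlog15]; positivity
  have hr1 : r ≤ 1 := by
    rw [hr, hlog15, div_le_one (by positivity)]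
    nlinarith
  -- Since log 15 < 3 ≤ L and ε ≥ 1/L, the rate is bounded below by a power of L alone.
  have hrL : 1 / (4 * L ^ 3) ≤ r := by
    rw [hr, hlog15]
    calc 1 / (4 * L ^ 3) = (1 / L) / (2 * L) ^ 2 := by field_simp; norm_num
      _ ≤ ε / (Real.log 15 + L) ^ 2 := by
        gcongr
        linarith [log_fifteen_lt]
  have hrl : 1 / (4 * l ^ 3) ≤ r := le_trans (by gcongr) hrL
  -- the crux
  set C := cruxNumber β G with hC
  have hmL : m ^ (4 * x) ≥ L ^ 40 := by
    rw [hm, ← pow_mul]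
    exact pow_le_pow_right₀ (by linarith) (by omega)
  have hCL : 3 * t ^ 2 * L ^ 40 ≤ C := by
    have : t ^ 2 * L ^ 40 ≤ t ^ 2 * m ^ (4 * x) := mul_le_mul_of_nonneg_left hmL (by positivity)
    linarith
  have hL40 : (1 : ℝ) ≤ L ^ 40 := one_le_pow₀ (by linarith)
  have ht2 : (1000 : ℝ) ^ 2 ≤ t ^ 2 := pow_le_pow_left₀ (by norm_num) ht1000.le 2
  have hCt : 3 * t ^ 2 ≤ C := by
    have : t ^ 2 * 1 ≤ t ^ 2 * L ^ 40 := mul_le_mul_of_nonneg_left hL40 (by positivity)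
    linarith
  have hC80 : (80 : ℝ) ≤ C := by linarith
  have hlogC : 0 < Real.log C := Real.log_pos (by linarith)
  -- This pays for the branches: q² pairs with 2J vertices each, where J is at most 2 log C.
  have htlog : t ^ 2 * Real.log C ≤ C := by
    have h1 : t ≤ Real.sqrt (C / Real.log C) := ht ▸ min_le_right _ _
    have h2 : t ^ 2 ≤ C / Real.log C := by
      rw [← Real.sq_sqrt (show 0 ≤ C / Real.log C by positivity)]
      exact pow_le_pow_left₀ ht0.le h1 2
    rwa [le_div_iff₀ hlogC] at h2
  have htD : t ≤ avgDegree G := (ht ▸ min_le_left _ _ : t ≤ d).trans hdD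
  -- the sizes of the trees
  set h := C / 40 with hh
  set J := Nat.log 2 h with hJ
  have hC80' : 80 ≤ C := by exact_mod_cast hC80
  have hh1 : C ≤ 80 * h := by omega
  have hh1' : (C : ℝ) ≤ 80 * h := by exact_mod_cast hh1
  have hJh : 2 ^ J ≤ h := Nat.pow_log_le_self 2 (by omega)
  have hhJ : h < 2 ^ J * 2 := by
    rw [← pow_succ]
    exact Nat.lt_pow_succ_log_self (by norm_num) h
  have hMC : C ≤ 80 * 2 ^ J := by omega
  have hMC' : (C : ℝ) ≤ 80 * ((2 ^ J : ℕ) : ℝ) := by exact_mod_cast hMC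
  have hJlog : (J : ℝ) ≤ 2 * Real.log C := by
    have h1 : ((2 : ℝ) ^ J) ≤ C := by
      have : 2 ^ J ≤ C := by omega
      exact_mod_cast this
    have h2 : (J : ℝ) * Real.log 2 ≤ Real.log C := by
      rw [← Real.log_pow]
      exact Real.log_le_log (by positivity) h1
    have h3 := Real.log_two_gt_d9
    have h4 : (0 : ℝ) ≤ J := Nat.cast_nonneg _
    nlinarith
  have hqq : (q : ℝ) * q ≤ t ^ 2 / 250000 := by
    have h1 : (q : ℝ) * q ≤ (t / 500) * (t / 500) :=
      mul_le_mul hqt hqt (Nat.cast_nonneg _) (by positivity)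
    linarith
  -- the number of rounds
  set i := ⌈8 * L / r⌉₊ with hi
  have hi1 : 8 * L / r ≤ i := Nat.le_ceil _
  have hi2 : (i : ℝ) ≤ 32 * L ^ 4 + 1 := by
    have h1 : (i : ℝ) < 8 * L / r + 1 := Nat.ceil_lt_add_one (by positivity)
    have h2 : 8 * L / r ≤ 8 * L / (1 / (4 * L ^ 3)) := by gcongr
    have h3 : 8 * L / (1 / (4 * L ^ 3)) = 32 * L ^ 4 := by field_simp; norm_num
    linarith
  have hround : (Fintype.card V : ℝ) ≤ (1 + r / 4) ^ i * k := by
    have h1 : Real.exp (r / 4 / 2) ^ i ≤ (1 + r / 4) ^ i :=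
      pow_le_pow_left₀ (Real.exp_pos _).le (exp_half_le_one_add (by positivity) (by linarith)) i
    rw [← Real.exp_nat_mul] at h1
    have h2 : L ≤ i * (r / 4 / 2) := by
      rw [div_le_iff₀ hr0] at hi1
      linarith
    have h3 : (n : ℝ) / k ≤ (1 + r / 4) ^ i := by
      calc (n : ℝ) / k = Real.exp L := by rw [hL, Real.exp_log (by positivity)]
        _ ≤ _ := (Real.exp_le_exp.2 h2).trans h1
    rw [hn]
    rwa [div_le_iff₀ hk0] at h3
  have hrM : t ^ 2 * L ^ 37 * (3 / 320) ≤ r * ((2 ^ J : ℕ) : ℝ) := by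
    calc t ^ 2 * L ^ 37 * (3 / 320) = 1 / (4 * L ^ 3) * (3 * t ^ 2 * L ^ 40 / 80) := by
          field_simp
          norm_num
      _ ≤ r * ((2 ^ J : ℕ) : ℝ) := by
          gcongr
          linarith
  -- Each factor r costs L^3 out of L^40; the remaining L^34 exceeds the L^4 needed for the
  -- connecting walks.
  have hrrM : t ^ 2 * L ^ 34 * (3 / 1280) ≤ r * (r * ((2 ^ J : ℕ) : ℝ)) := by
    calc t ^ 2 * L ^ 34 * (3 / 1280) = 1 / (4 * L ^ 3) * (t ^ 2 * L ^ 37 * (3 / 320)) := by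
          field_simp
          norm_num
      _ ≤ _ := by gcongr
  have hLpow : (1000 : ℝ) ^ 2 ≤ L ^ 30 :=
    (pow_le_pow_left₀ (by norm_num) hL1000 2).trans (pow_le_pow_right₀ (by linarith) (by norm_num))
  have hL4 : (1 : ℝ) ≤ L ^ 4 := one_le_pow₀ (by linarith)
  have htL4 : 0 < t ^ 2 * L ^ 4 := by positivity
  have hL30 : t ^ 2 * L ^ 4 * 1000 ^ 2 ≤ t ^ 2 * L ^ 34 := by
    calc t ^ 2 * L ^ 4 * 1000 ^ 2 ≤ t ^ 2 * L ^ 4 * L ^ 30 := by gcongr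
      _ = t ^ 2 * L ^ 34 := by ring
  refine containsSubdivision_top_of_expandsAtRate (k := k) (r := r) (i := i) (J := J) (h := h)
    (w := q * q * (2 * i + 2 + 1)) hβ hβ' hD0 hk0 hr0 hr1 hexp ?_ ?_ ?_ hq1.le ?_ ?_ ?_ hJh ?_ ?_
    le_rfl ?_ ?_ hround
  · rw [hn]; linarith
  · rw [hn]
    have h1 : (1000 : ℝ) ^ 3 * l ≤ l ^ 3 * l :=
      mul_le_mul_of_nonneg_right (pow_le_pow_left₀ (by norm_num) hl1000 3) hl0.le
    calc 960 * l ≤ l ^ 4 / 16 := by rw [pow_succ l 3]; linarith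
      _ = 1 / (4 * l ^ 3) * (l ^ 10 * (1 / (4 * l ^ 3))) := by field_simp; norm_num
      _ ≤ r * (avgDegree G * r) := by gcongr
  · rw [hn]; linarith
  · push_cast; linarith
  · have h1 : (2 * (2 * q * (4 * q + 1)) : ℝ) < C := by
      have h2 : (1 : ℝ) * q ≤ q * q :=
        mul_le_mul_of_nonneg_right (by exact_mod_cast hq1.le) (Nat.cast_nonneg _)
      linarith
    exact_mod_cast h1
  · omega
  · omega
  · have h1 : (q : ℝ) * q * (2 * J) ≤ h := by
      calc (q : ℝ) * q * (2 * J) ≤ t ^ 2 / 250000 * (2 * (2 * Real.log C)) := by gcongr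
        _ = t ^ 2 * Real.log C / 62500 := by ring
        _ ≤ h := by linarith
    exact_mod_cast h1
  · have h1 : t ^ 2 * L ^ 34 ≤ t ^ 2 * L ^ 37 :=
      mul_le_mul_of_nonneg_left (pow_le_pow_right₀ (by linarith) (by norm_num)) (by positivity)
    rw [hm] at hkt
    linarith
  · have h1 : ((q * q * (2 * i + 2 + 1) : ℕ) : ℝ) ≤ t ^ 2 / 250000 * (70 * L ^ 4) := by
      push_cast
      gcongr
      linarith
    linarith
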